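/- Identify $\{0,1\}^n$ with $\{-1,1\}^n$ ($0\leftrightarrow -1$), write $|x|$ for the number of ones of $x$ and $\log$ for $\log_2$. A function $f:\{0,1\}^n\to\{0,1\}$ is a $\rho$-regular linear threshold function (LTF) if there are $w_1,\dots,w_n,\theta\in\mathbb R$ with $f(x)=1\iff\sum_i w_ix_i-\theta\ge 0$ (with $x_i=\pm1$) and $|w_i|\le\rho\sqrt{\sum_j w_j^2}$ for all $i$. It is monotone if $x\preceq y$ coordinatewise implies $f(x)\le f(y)$, and $\epsilon$-far from monotone if it differs from every monotone function on at least $\epsilon2^n$ points. The truncation $\mathrm{Trunc}_\delta(f)$ is $0$ where $|x|<\frac n2-\delta\sqrt n$, is $1$ where $|x|>\frac n2+\delta\sqrt n$, and equals $f$ on the remaining points, the $\delta$-middle layers. A randomized (adaptive) query algorithm is a probability distribution on decision trees; its query complexity is the largest depth of a tree in its support. Say that it tests a class $\mathcal F$ if it accepts every monotone $f\in\mathcal F$ with certainty and rejects every $f\in\mathcal F$ that is $\epsilon$-far from monotone with probability at least $\frac12$. The bisection algorithm with parameters $m,k,s$: draw $x$ uniformly, then draw $y$ uniformly, at most $m$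 times, until $f(x)\ne f(y)$; accept if this fails; swap if necessary so that $f(x)=0$, $f(y)=1$. Then $k$ times: draw $z$ uniformly among the points that agree with $x$ and $y$ wherever these agree; if $f(z)=0$, replace $x$ by $z$, otherwise replace $y$ by $z$. Finally, if $x$ and $y$ differ in more than $s$ coordinates, accept; otherwise query all points that agree with $x$ and $y$ wherever these agree, and reject if and only if $f$ decreases along some (upward) edge of this subcube. **Theorem.** Fix $\epsilon>0$ and $\tau>0$. There are constants $C$, $\delta_0>0$ and natural numbers $n_0,m,s,R$, depending only on $\epsilon$ and $\tau$, such that for every $n\ge1$: (a) There is a randomized adaptive algorithm $\mathcal A$ that makes at most $C+\log n$ queries, all of them in the $\delta_0$-middle layers, and that tests the class of all $\frac{\tau}{\sqrt n}$-regular LTFs: it always accepts the monotone ones, and rejects those that are $\epsilon$-far from monotone with probability at least $\frac12$. The same $\mathcal A$ tests the class of all $\mathrm{Trunc}_\delta(f)$ with $\delta\ge\delta_0$ and $f$ a $\frac\tau{\sqrt n}$-regular LTF. If $n\ge n_0$, then $\mathcal A$ is the bisection algorithm with parameters $m,k,s$ for some $k$ (which may depend on $n$), modified to stop and accept instead of making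 a query outside of the $\delta_0$-middle layers. (b) There is a randomized adaptive algorithm $\mathcal B$ that makes at most $C(1+\log n)$ queries and tests the class of all $\mathrm{Trunc}_\delta(f)$ with $\delta>0$ arbitrary (not known to the algorithm) and $f$ a $\frac\tau{\sqrt n}$-regular LTF. If $n\ge n_0$, then $\mathcal B$ consists of $R$ independent runs of the bisection algorithm with parameters $m,k,s$ for some $k$ (which may depend on $n$), and rejects if and only if one of the runs rejects. -/

import Mathlib

/-- The Boolean hypercube, with coordinatewise order; `false` stands for `0` (or `-1`)
and `true` for `1`. -/
abbrev Cube (n : ℕ) : Type := Fin n → Bool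

/-- The Hamming weight `|x|`, the number of coordinates equal to `1`. -/
def Cube.weight {n : ℕ} (x : Cube n) : ℕ := (Finset.univ.filter fun i => x i = true).card

/-- The set of coordinates on which `x` and `y` differ. -/
def Cube.diff {n : ℕ} (x y : Cube n) : Finset (Fin n) := Finset.univ.filter fun i => x i ≠ y i

/-- The subcube of all `z` that agree with `x` and `y` wherever `x` and `y` agree. -/
def Cube.hybrid {n : ℕ} (x y : Cube n) : Finset (Cube n) :=
  Finset.univ.filter fun z => ∀ i, x i = y i → z i = x i

/-- Copy the seed `r` on the coordinates where `x` and `y` differ. If `r` is uniform in the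
cube, then the result is uniform in `Cube.hybrid x y`. -/
def Cube.mix {n : ℕ} (r x y : Cube n) : Cube n := fun i => if x i = y i then x i else r i

/-- The middle layers `n/2 - δ√n ≤ |x| ≤ n/2 + δ√n` of the cube. -/
def middleLayers (n : ℕ) (δ : ℝ) : Set (Cube n) :=
  {x | (n : ℝ) / 2 - δ * Real.sqrt n ≤ (x.weight : ℝ) ∧
    (x.weight : ℝ) ≤ (n : ℝ) / 2 + δ * Real.sqrt n}

open Classical in
/-- The `δ`-truncation of `f`: equal to `f` on the middle layers, `0` below, `1` above. -/
noncomputable def truncate {n : ℕ} (δ : ℝ) (f : Cube n → Bool) : Cube n → Bool := fun x =>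
  if (x.weight : ℝ) < (n : ℝ) / 2 - δ * Real.sqrt n then false
  else if (n : ℝ) / 2 + δ * Real.sqrt n < (x.weight : ℝ) then true
  else f x

/-- The `±1` value of a bit. -/
def bitSign (b : Bool) : ℝ := if b then 1 else -1

/-- `f` is the linear threshold function `sgn (∑ i, w i * x i - θ)` on `{-1,1}ⁿ`,
where `sgn` is `1` exactly on the nonnegative reals. -/
def IsLTFWith {n : ℕ} (f : Cube n → Bool) (w : Fin n → ℝ) (θ : ℝ) : Prop :=
  ∀ x, f x = true ↔ 0 ≤ (∑ i, w i * bitSign (x i)) - θ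

/-- `f` is a `τ`-regular linear threshold function: it has a representation in which every
weight is at most `τ` times the Euclidean norm of the weight vector. -/
def IsRegularLTF {n : ℕ} (τ : ℝ) (f : Cube n → Bool) : Prop :=
  ∃ (w : Fin n → ℝ) (θ : ℝ), IsLTFWith f w θ ∧ ∀ i, |w i| ≤ τ * Real.sqrt (∑ j, w j ^ 2)

/-- `f` differs from every monotone function on at least `ε * 2 ^ n` points. -/
def IsFarFromMonotone {n : ℕ} (ε : ℝ) (f : Cube n → Bool) : Prop :=
  ∀ g : Cube n → Bool, Monotone g →
    ε * 2 ^ n ≤ ((Finset.univ.filter fun x => f x ≠ g x).card : ℝ)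

/-- Deterministic adaptive query algorithms (decision trees). `leaf true` accepts, `leaf false`
rejects, and `query x t₀ t₁` asks for the value at `x` and continues with `t₀` if it is `0`
and with `t₁` if it is `1`. -/
inductive DTree (n : ℕ) : Type
  | leaf (accept : Bool) : DTree n
  | query (x : Cube n) (t₀ t₁ : DTree n) : DTree n

namespace DTree

variable {n : ℕ}

/-- The verdict of the algorithm when the oracle is `f`. -/
def run (f : Cube n → Bool) : DTree n → Bool
  | leaf b => b
  | query x t₀ t₁ => if f x = true then run f t₁ else run f t₀

/-- The largest number of queries on a branch. -/
def depth : DTree n → ℕ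
  | leaf _ => 0
  | query _ t₀ t₁ => max (depth t₀) (depth t₁) + 1

/-- All queries lie in the set `M`. -/
def QueriesIn (M : Set (Cube n)) : DTree n → Prop
  | leaf _ => True
  | query x t₀ t₁ => x ∈ M ∧ QueriesIn M t₀ ∧ QueriesIn M t₁

open Classical in
/-- Stop and accept instead of making a query outside of `M`. -/
noncomputable def restrict (M : Set (Cube n)) : DTree n → DTree n
  | leaf b => leaf b
  | query x t₀ t₁ => if x ∈ M then query x (restrict M t₀) (restrict M t₁) else leaf true

/-- Run the first algorithm; if it accepts, run the second one. Thus the combination rejects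
if and only if one of the two rejects. -/
def andThen : DTree n → DTree n → DTree n
  | leaf true, T => T
  | leaf false, _ => leaf false
  | query x t₀ t₁, T => query x (andThen t₀ T) (andThen t₁ T)

/-- Query all points of a list, recording the answers in `g`, and continue with `next g`. -/
def queryAll (next : (Cube n → Bool) → DTree n) : List (Cube n) → (Cube n → Bool) → DTree n
  | [], g => next g
  | x :: xs, g => query x (queryAll next xs (Function.update g x false))
      (queryAll next xs (Function.update g x true))

open Classical in
/-- The last phase of bisection: if `x` and `y` differ in more than `s` coordinates, accept;
otherwise query all of `Cube.hybrid x y` and reject if and only if the function decreases along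
some edge of this subcube. -/
noncomputable def finish (s : ℕ) (x y : Cube n) : DTree n :=
  if s < (Cube.diff x y).card then leaf true
  else queryAll
    (fun g => leaf (decide (∀ u ∈ Cube.hybrid x y, ∀ v ∈ Cube.hybrid x y,
      u ≤ v → (Cube.diff u v).card = 1 → g u ≤ g v)))
    (Cube.hybrid x y).toList (fun _ => false)

/-- The bisection loop between a point `x` of value `0` and a point `y` of value `1`, with one
iteration for each seed: query a point `z` of `Cube.hybrid x y` and replace `x` or `y` by it. -/
noncomputable def bisect (s : ℕ) : List (Cube n) → Cube n → Cube n → DTree n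
  | [], x, y => finish s x y
  | r :: rs, x, y =>
      query (Cube.mix r x y) (bisect s rs (Cube.mix r x y) y) (bisect s rs x (Cube.mix r x y))

/-- Given the value `b` at `x`, query the points of the list `ys` until one of them has a value
other than `b`, and start the bisection there. If there is no such point, accept. -/
noncomputable def search (s : ℕ) (rs : List (Cube n)) (x : Cube n) (b : Bool) :
    List (Cube n) → DTree n
  | [] => leaf true
  | y :: ys =>
      if b = true then query y (bisect s rs y x) (search s rs x b ys)
      else query y (search s rs x b ys) (bisect s rs x y)

/-- The bisection algorithm with all its random choices fixed: the first point `x`, the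
candidates `ys` for the second point, and the seeds `rs` for the loop. -/
noncomputable def bisection (s : ℕ) (x : Cube n) (ys rs : List (Cube n)) : DTree n :=
  query x (search s rs x false ys) (search s rs x true ys)

end DTree

/-- Randomized adaptive query algorithms: probability distributions on decision trees. -/
abbrev RandAlg (n : ℕ) : Type := PMF (DTree n)

namespace RandAlg

variable {n : ℕ}

/-- On every outcome of the coins and all answers, at most `q` queries are made. -/
def QueriesAtMost (A : RandAlg n) (q : ℝ) : Prop := ∀ T ∈ A.support, (T.depth : ℝ) ≤ q

/-- On every outcome of the coins and all answers, only points of `M` are queried. -/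
def QueriesIn (A : RandAlg n) (M : Set (Cube n)) : Prop := ∀ T ∈ A.support, T.QueriesIn M

/-- `A` accepts `f` on every outcome of the coins. -/
def AlwaysAccepts (A : RandAlg n) (f : Cube n → Bool) : Prop :=
  ∀ T ∈ A.support, T.run f = true

/-- The probability that `A` rejects `f`. -/
noncomputable def rejectProb (A : RandAlg n) (f : Cube n → Bool) : ENNReal :=
  (A.map fun T => T.run f) false

/-- `A` is a one-sided `ε`-tester for monotonicity of functions promised to be in `F`. -/
def TestsMonotonicity (A : RandAlg n) (ε : ℝ) (F : Set (Cube n → Bool)) : Prop :=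
  (∀ f ∈ F, Monotone f → A.AlwaysAccepts f) ∧
    ∀ f ∈ F, IsFarFromMonotone ε f → 1 / 2 ≤ A.rejectProb f

/-- The randomized bisection algorithm: draw a point `x` and at most `m` points `y` uniformly and
independently until `x` and `y` have different values (accept if this fails), make `k` random
bisection steps between `x` and `y`, and inspect the remaining subcube if its dimension is at
most `s`. -/
noncomputable def bisection (n m k s : ℕ) : RandAlg n :=
  (PMF.uniformOfFintype (Cube n × (Fin m → Cube n) × (Fin k → Cube n))).map
    fun c => DTree.bisection s c.1 (List.ofFn c.2.1) (List.ofFn c.2.2)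

/-- Stop and accept instead of making a query outside of `M`. -/
noncomputable def restrict (A : RandAlg n) (M : Set (Cube n)) : RandAlg n :=
  A.map fun T => T.restrict M

/-- `R` independent runs of `A`, rejecting if and only if some run rejects. -/
noncomputable def runs (A : RandAlg n) : ℕ → RandAlg n
  | 0 => PMF.pure (DTree.leaf true)
  | R + 1 => A.bind fun T => (runs A R).map fun T' => T.andThen T'

end RandAlg

/-- The `τ / √n`-regular linear threshold functions of `n` variables. -/
def regularLTFs (n : ℕ) (τ : ℝ) : Set (Cube n → Bool) :=
  {f | IsRegularLTF (τ / Real.sqrt n) f}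

/-- The `δ`-truncations, over all `δ` in `D`, of `τ / √n`-regular linear threshold functions. -/
def truncatedRegularLTFs (n : ℕ) (τ : ℝ) (D : Set ℝ) : Set (Cube n → Bool) :=
  {h | ∃ δ ∈ D, ∃ f ∈ regularLTFs n τ, h = truncate δ f}

/-!
The proof is elementary; no central limit theorem is needed.

**Many negative weights.** If a regular threshold function has few sizable negative weights, then
replacing all negative weights by `0` changes it on few points only: the negative part of the sum
is small by Chebyshev, and by Littlewood–Offord (Sperner) the positive part is rarely so close to
the threshold. As the new function is monotone, a regular threshold function that is `ε`-far from
monotone has at least `c * n` weights below `-c / √n` times the norm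
(`exists_le_card_negativeWeights`).

**The final subcube.** If a threshold function takes both values on a subcube, and the negative
weights at the free coordinates together outweigh each single positive weight, then it decreases
along an edge of the subcube (`IsLTFWith.exists_decreasing_edge`). By regularity, a constant number
of sizable negative weights among the free coordinates is enough.

**The loop.** A random seed splits the set of coordinates in which `x` and `y` differ at random,
and the value at the new point decides which of the two parts is kept. This choice is not
independent of the seed, but both parts deviate from one half of the set by the same amount
(`BisectState.step`). So Chebyshev and a union bound over the steps, with geometric series of
deviations, show that the loop most likely ends with a set of at most `s` coordinates that contains
enough negative weights, and that all its points have weights close to those of `x` and `y`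
(`BisectState.bisectFail_le`). Together with the analysis of the search for the first pair this
gives the tester for wide middle layers (`half_le_prob_of_wide`).

**Thin middle layers.** The truncation is far from monotone only if its width is at least a
constant depending on `ε`, and it then takes both values often at some distance from the boundary
of the middle layers. A new point of the loop stays in these layers with constant probability,
since binomial distributions are unimodal (`exists_le_prob_sum_bitSign`). After a constant number
`T` of such steps the remaining deviations are smaller than the distance to the boundary. So a
single run rejects with constant probability (`le_prob_of_truncate`), and independent runs amplify
it.

Small `n` are dealt with by exhaustive search, and `δ₀` is so large that the middle layers are then
the whole cube.
-/

open scoped BigOperators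

/-! ### Uniform probability on finite types -/

open Classical in
/-- The probability of `p` under the uniform distribution on a finite type, as a real number. -/
noncomputable def prob {α : Type*} [Fintype α] (p : α → Prop) : ℝ := 𝔼 a, if p a then 1 else 0

section Prob

variable {α β : Type*} [Fintype α] [Fintype β]

theorem prob_eq_card_div (p : α → Prop) [DecidablePred p] :
    prob p = ((Finset.univ.filter p).card : ℝ) / Fintype.card α := by
  classical
  rw [prob, Fintype.expect_eq_sum_div_card, Finset.card_filter]
  push_cast
  congr!

theorem prob_nonneg (p : α → Prop) : 0 ≤ prob p :=
  Finset.expect_nonneg fun a _ => by split_ifs <;> norm_num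

theorem prob_mono {p q : α → Prop} (h : ∀ a, p a → q a) : prob p ≤ prob q := by
  refine Finset.expect_le_expect fun a _ => ?_
  by_cases hp : p a
  · simp [hp, h a hp]
  · simp only [hp, if_false]
    split_ifs <;> norm_num

theorem prob_congr {p q : α → Prop} (h : ∀ a, p a ↔ q a) : prob p = prob q :=
  congrArg prob (funext fun a => propext (h a))

theorem prob_or_le (p q : α → Prop) : prob (fun a => p a ∨ q a) ≤ prob p + prob q := by
  rw [prob, prob, prob, ← Finset.expect_add_distrib]
  refine Finset.expect_le_expect fun a _ => ?_
  by_cases hp : p a <;> by_cases hq : q a <;> simp [hp, hq]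

theorem prob_add_prob_not [Nonempty α] (p : α → Prop) : prob p + prob (fun a => ¬ p a) = 1 := by
  rw [prob, prob, ← Finset.expect_add_distrib]
  calc _ = 𝔼 _a : α, (1 : ℝ) := by
        refine Finset.expect_congr rfl fun a _ => ?_
        by_cases hp : p a <;> simp [hp]
    _ = 1 := Finset.expect_const Finset.univ_nonempty _

theorem prob_le_one [Nonempty α] (p : α → Prop) : prob p ≤ 1 := by
  linarith [prob_add_prob_not p, prob_nonneg fun a => ¬ p a]

theorem prob_equiv (e : α ≃ β) (p : β → Prop) : prob (fun a => p (e a)) = prob p := by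
  unfold prob
  exact Fintype.expect_equiv e _ _ fun _ => rfl

theorem expect_prod_type (F : α × β → ℝ) : 𝔼 c, F c = 𝔼 a, 𝔼 b, F (a, b) := by
  rw [← Finset.expect_product, Finset.univ_product_univ]

/-- Chebyshev's inequality for the second moment about zero. -/
theorem prob_le_abs_le (X : α → ℝ) {t v : ℝ} (ht : 0 < t) (hv : 𝔼 a, X a ^ 2 ≤ v) :
    prob (fun a => t ≤ |X a|) ≤ v / t ^ 2 := by
  rw [le_div_iff₀ (by positivity), prob, Finset.expect_mul]
  refine le_trans (Finset.expect_le_expect fun a _ => ?_) hv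
  by_cases h : t ≤ |X a|
  · simpa [h] using pow_le_pow_left₀ ht.le h 2
  · simpa [h] using sq_nonneg (X a)

end Prob

/-- The expectation of `F` over a list of `k` independent uniform elements of `α`. -/
noncomputable def expectList (α : Type*) [Fintype α] : ℕ → (List α → ℝ) → ℝ
  | 0, F => F []
  | k + 1, F => 𝔼 a : α, expectList α k fun l => F (a :: l)

section ExpectList

variable {α : Type*} [Fintype α]

theorem expect_ofFn (k : ℕ) (F : List α → ℝ) :
    𝔼 r : Fin k → α, F (List.ofFn r) = expectList α k F := by
  induction k generalizing F with
  | zero => simp [expectList]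
  | succ k ih =>
    rw [expectList, ← Fintype.expect_equiv (Fin.consEquiv fun _ => α)
      (fun c => F (c.1 :: List.ofFn c.2)) _ fun c => ?_, expect_prod_type]
    · exact Finset.expect_congr rfl fun a _ => ih fun l => F (a :: l)
    · simp [Fin.consEquiv, List.ofFn_succ]

theorem expectList_mono {k : ℕ} {F G : List α → ℝ} (h : ∀ l, F l ≤ G l) :
    expectList α k F ≤ expectList α k G := by
  induction k generalizing F G with
  | zero => exact h _
  | succ k ih => exact Finset.expect_le_expect fun a _ => ih fun l => h _

theorem expectList_const [Nonempty α] (k : ℕ) (c : ℝ) : expectList α k (fun _ => c) = c := by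
  induction k with
  | zero => rfl
  | succ k ih => simp [expectList, ih]

end ExpectList

/-! ### Random signs -/

theorem bitSign_mul_self (b : Bool) : bitSign b * bitSign b = 1 := by cases b <;> simp [bitSign]

theorem bitSign_not (b : Bool) : bitSign (!b) = -bitSign b := by cases b <;> simp [bitSign]

theorem abs_bitSign (b : Bool) : |bitSign b| = 1 := by cases b <;> simp [bitSign]

/-- The involution of the cube that flips the coordinate `i`. -/
def flipEquiv {n : ℕ} (i : Fin n) : Cube n ≃ Cube n where
  toFun x := Function.update x i (!x i)
  invFun x := Function.update x i (!x i)
  left_inv x := by simp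
  right_inv x := by simp

/-- The involution of the cube that flips all coordinates. -/
def complEquiv (n : ℕ) : Cube n ≃ Cube n where
  toFun x := fun i => !x i
  invFun x := fun i => !x i
  left_inv x := by simp
  right_inv x := by simp

theorem expect_bitSign_mul_bitSign {n : ℕ} {i j : Fin n} (h : i ≠ j) :
    𝔼 r : Cube n, bitSign (r i) * bitSign (r j) = 0 := by
  have h1 : 𝔼 r : Cube n, bitSign (r i) * bitSign (r j)
      = 𝔼 r : Cube n, -(bitSign (r i) * bitSign (r j)) := by
    refine Fintype.expect_equiv (flipEquiv i) _ _ fun r => ?_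
    simp [flipEquiv, h.symm, bitSign_not]
  rw [Finset.expect_neg_distrib] at h1
  linarith

theorem expect_sum_bitSign_sq {n : ℕ} (u : Fin n → ℝ) :
    𝔼 r : Cube n, (∑ i, u i * bitSign (r i)) ^ 2 = ∑ i, u i ^ 2 := by
  have h1 : ∀ r : Cube n, (∑ i, u i * bitSign (r i)) ^ 2
      = ∑ i, ∑ j, u i * u j * (bitSign (r i) * bitSign (r j)) := fun r => by
    rw [sq, Finset.sum_mul_sum]
    exact Finset.sum_congr rfl fun i _ => Finset.sum_congr rfl fun j _ => by ring
  simp_rw [h1, Finset.expect_sum_comm, ← Finset.mul_expect]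
  refine Finset.sum_congr rfl fun i _ => ?_
  rw [Finset.sum_eq_single i]
  · simp [bitSign_mul_self, sq]
  · intro j _ hj
    rw [expect_bitSign_mul_bitSign hj.symm, mul_zero]
  · simp

/-- Chebyshev's inequality for a signed sum of random signs over a set `S` of coordinates. -/
theorem prob_le_abs_sum_bitSign {n : ℕ} (S : Finset (Fin n)) (v : Fin n → ℝ)
    (hv : ∀ i, |v i| = 1) {t : ℝ} (ht : 0 < t) :
    prob (fun r : Cube n => t ≤ |∑ i ∈ S, v i * bitSign (r i)|) ≤ S.card / t ^ 2 := by
  refine prob_le_abs_le _ ht (le_of_eq ?_)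
  have h := expect_sum_bitSign_sq fun i => if i ∈ S then v i else 0
  simp only [ite_mul, zero_mul, Finset.sum_ite_mem, Finset.univ_inter, ite_pow] at h
  rw [h]
  simp [← sq_abs (v _), hv]

/-! ### Anticoncentration of sums of random signs -/

theorem centralBinom_sq_mul_le (m : ℕ) : m.centralBinom ^ 2 * (3 * m + 1) ≤ 16 ^ m := by
  induction m with
  | zero => simp
  | succ m ih =>
    have h := Nat.succ_mul_centralBinom_succ m
    refine Nat.le_of_mul_le_mul_left ?_ (by positivity : 0 < (m + 1) ^ 2)
    calc (m + 1) ^ 2 * ((m + 1).centralBinom ^ 2 * (3 * (m + 1) + 1))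
        = ((m + 1) * (m + 1).centralBinom) ^ 2 * (3 * m + 4) := by ring
      _ = m.centralBinom ^ 2 * (4 * ((2 * m + 1) ^ 2 * (3 * m + 4))) := by rw [h]; ring
      _ ≤ m.centralBinom ^ 2 * (4 * (4 * (3 * m + 1) * (m + 1) ^ 2)) := by
          gcongr _ * (4 * ?_)
          nlinarith
      _ = (m + 1) ^ 2 * 16 * (m.centralBinom ^ 2 * (3 * m + 1)) := by ring
      _ ≤ (m + 1) ^ 2 * 16 * 16 ^ m := by gcongr
      _ = (m + 1) ^ 2 * 16 ^ (m + 1) := by ring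

theorem choose_half_sq_mul_le (n : ℕ) : n.choose (n / 2) ^ 2 * n ≤ (2 ^ n) ^ 2 := by
  obtain ⟨m, rfl | rfl⟩ := Nat.even_or_odd' n
  · have h := centralBinom_sq_mul_le m
    rw [Nat.centralBinom_eq_two_mul_choose] at h
    rw [Nat.mul_div_cancel_left _ (by norm_num)]
    calc _ ≤ (2 * m).choose m ^ 2 * (3 * m + 1) := by gcongr; omega
      _ ≤ _ := h
      _ = _ := by rw [← pow_mul, show 2 * m * 2 = 4 * m by ring, pow_mul]; norm_num
  · have h := centralBinom_sq_mul_le (m + 1)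
    have h2 : (m + 1).centralBinom = 2 * (2 * m + 1).choose m := by
      rw [Nat.centralBinom_eq_two_mul_choose, show 2 * (m + 1) = 2 * m + 1 + 1 by ring,
        Nat.choose_succ_succ, ← Nat.choose_symm_half m, two_mul ((2 * m + 1).choose _)]
    rw [h2] at h
    rw [show (2 * m + 1) / 2 = m by omega]
    refine Nat.le_of_mul_le_mul_left ?_ (by norm_num : 0 < 4)
    calc _ = (2 * (2 * m + 1).choose m) ^ 2 * (2 * m + 1) := by ring
      _ ≤ (2 * (2 * m + 1).choose m) ^ 2 * (3 * (m + 1) + 1) :=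
          Nat.mul_le_mul_left _ (by omega)
      _ ≤ _ := h
      _ = _ := by rw [show 16 = 2 ^ 4 by norm_num, ← pow_mul]; ring

theorem choose_half_div_two_pow_le {n : ℕ} (hn : 1 ≤ n) :
    (n.choose (n / 2) : ℝ) / 2 ^ n ≤ 1 / Real.sqrt n := by
  have hs : 0 < Real.sqrt n := Real.sqrt_pos.2 (by exact_mod_cast hn)
  rw [div_le_div_iff₀ (by positivity) hs, one_mul]
  refine le_of_sq_le_sq ?_ (by positivity)
  rw [mul_pow, Real.sq_sqrt (by positivity)]
  exact_mod_cast choose_half_sq_mul_le n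

/-- The correspondence between `0/1`-vectors and sets of coordinates. -/
def boolFunEquivFinset (ι : Type*) [Fintype ι] [DecidableEq ι] : (ι → Bool) ≃ Finset ι where
  toFun x := Finset.univ.filter fun i => x i = true
  invFun T := fun i => decide (i ∈ T)
  left_inv x := by ext; simp
  right_inv T := by ext; simp

/-- The Littlewood–Offord bound when all weights are at least `c`: by Sperner's theorem, since
the points with a sum in an interval of length `2 * c` form an antichain. -/
theorem prob_sum_mem_Ico_le_choose {ι : Type*} [Fintype ι] [DecidableEq ι] {w : ι → ℝ} {c : ℝ} (hc : 0 < c)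
    (hw : ∀ i, c ≤ w i) (a : ℝ) :
    prob (fun x : ι → Bool => a ≤ ∑ i, w i * bitSign (x i) ∧
        ∑ i, w i * bitSign (x i) < a + 2 * c)
      ≤ ((Fintype.card ι).choose (Fintype.card ι / 2) : ℝ) / 2 ^ Fintype.card ι := by
  classical
  set e := (boolFunEquivFinset ι).symm with he
  rw [← prob_equiv e, prob_eq_card_div, Fintype.card_finset]
  push_cast
  gcongr
  refine IsAntichain.sperner fun A hA B hB hne hAB => ?_
  simp only [Finset.coe_filter, Finset.mem_univ, true_and, Set.mem_ofPred_eq] at hA hB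
  obtain ⟨j, hjB, hjA⟩ := Finset.exists_of_ssubset (lt_of_le_of_ne hAB hne)
  have h1 : ∀ i, w i * bitSign (e A i) + (if i = j then 2 * c else 0)
      ≤ w i * bitSign (e B i) := fun i => by
    have hwi := hw i
    by_cases hij : i = j
    · subst hij
      simp [he, boolFunEquivFinset, bitSign, hjA, hjB]
      linarith
    · by_cases hiA : i ∈ A
      · simp [he, boolFunEquivFinset, bitSign, hij, hiA, hAB hiA]
      · by_cases hiB : i ∈ B <;> simp [he, boolFunEquivFinset, bitSign, hij, hiA, hiB]
        linarith
  have h2 := Finset.sum_le_sum fun i (_ : i ∈ Finset.univ) => h1 i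
  rw [Finset.sum_add_distrib] at h2
  simp at h2
  linarith [hA.1, hB.2]

variable {n : ℕ}

/-- Splitting a random point of the cube into its parts on `S` and off `S`. -/
theorem expect_cube_split (S : Finset (Fin n)) (F : Cube n → ℝ) :
    𝔼 x, F x = 𝔼 b : {i // ¬ i ∈ S} → Bool, 𝔼 a : {i // i ∈ S} → Bool,
      F ((Equiv.piEquivPiSubtypeProd (fun i => i ∈ S) fun _ => Bool).symm (a, b)) := by
  rw [← Fintype.expect_equiv (Equiv.piEquivPiSubtypeProd (fun i => i ∈ S) fun _ => Bool).symm
    (fun c => F ((Equiv.piEquivPiSubtypeProd (fun i => i ∈ S) fun _ => Bool).symm c)) F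
    fun _ => rfl, expect_prod_type, Finset.expect_comm]

open Classical in
theorem prob_cube_split (S : Finset (Fin n)) (p : Cube n → Prop) :
    prob p = 𝔼 b : {i // ¬ i ∈ S} → Bool, prob fun a : {i // i ∈ S} → Bool =>
      p ((Equiv.piEquivPiSubtypeProd (fun i => i ∈ S) fun _ => Bool).symm (a, b)) :=
  expect_cube_split S fun x => if p x then 1 else 0

/-- The Littlewood–Offord bound when the weights on `S` are at least `c`, for an interval of
length less than `2 * c`. The weights off `S` are arbitrary. -/
theorem prob_sum_mem_Ico_le {w : Fin n → ℝ} {S : Finset (Fin n)} {c : ℝ} (hc : 0 < c)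
    (hw : ∀ i ∈ S, c ≤ w i) (hS : S.Nonempty) (a : ℝ) :
    prob (fun x : Cube n => a ≤ ∑ i, w i * bitSign (x i) ∧
        ∑ i, w i * bitSign (x i) < a + 2 * c) ≤ 1 / Real.sqrt S.card := by
  rw [prob_cube_split S]
  refine Finset.expect_le (by simp) fun b _ => ?_
  set t : ℝ := ∑ i : {i // ¬ i ∈ S}, w i * bitSign (b i) with ht
  have key := prob_sum_mem_Ico_le_choose (w := fun i : {i // i ∈ S} => w i) hc
    (fun i => hw i i.2) (a - t)
  rw [Fintype.card_coe] at key
  refine le_trans (le_of_eq ?_) (key.trans (choose_half_div_two_pow_le hS.card_pos))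
  refine prob_congr fun x => ?_
  have h : ∑ i, w i * bitSign ((Equiv.piEquivPiSubtypeProd (fun i => i ∈ S)
      fun _ => Bool).symm (x, b) i) = ∑ i : {i // i ∈ S}, w i * bitSign (x i) + t := by
    rw [← Fintype.sum_subtype_add_sum_subtype (fun i => i ∈ S), ht]
    congr 1
    · exact Finset.sum_congr (by ext; simp) fun i _ => by
        simp [Equiv.piEquivPiSubtypeProd, i.2]
    · exact Finset.sum_congr rfl fun i _ => by simp [Equiv.piEquivPiSubtypeProd, i.2]
  simp only [h]
  constructor <;> rintro ⟨h1, h2⟩ <;> constructor <;> linarith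

/-- The Littlewood–Offord bound for an interval of any length `ℓ`, which is covered by
`⌊ℓ / (2 * c)⌋ + 1` half-open intervals of length `2 * c`. -/
theorem prob_sum_mem_Icc_le {w : Fin n → ℝ} {S : Finset (Fin n)} {c : ℝ} (hc : 0 < c)
    (hw : ∀ i ∈ S, c ≤ w i) (hS : S.Nonempty) (a : ℝ) {ℓ : ℝ} (hl : 0 ≤ ℓ) :
    prob (fun x : Cube n => a ≤ ∑ i, w i * bitSign (x i) ∧
        ∑ i, w i * bitSign (x i) ≤ a + ℓ) ≤ (ℓ / (2 * c) + 1) / Real.sqrt S.card := by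
  have key : ∀ N : ℕ, prob (fun x : Cube n => a ≤ ∑ i, w i * bitSign (x i) ∧
      ∑ i, w i * bitSign (x i) < a + 2 * c * N) ≤ N / Real.sqrt S.card := fun N => by
    induction N with
    | zero =>
      refine le_of_eq_of_le ?_ (by simp : (0 : ℝ) ≤ _)
      refine (Finset.expect_eq_zero fun x _ => if_neg ?_)
      simp
    | succ N ih =>
      calc _ ≤ prob (fun x : Cube n => (a ≤ ∑ i, w i * bitSign (x i) ∧
              ∑ i, w i * bitSign (x i) < a + 2 * c * N) ∨
            (a + 2 * c * N ≤ ∑ i, w i * bitSign (x i) ∧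
              ∑ i, w i * bitSign (x i) < a + 2 * c * N + 2 * c)) := prob_mono fun x hx => by
            rcases lt_or_ge (∑ i, w i * bitSign (x i)) (a + 2 * c * N) with h | h
            · exact Or.inl ⟨hx.1, h⟩
            · refine Or.inr ⟨h, hx.2.trans_eq ?_⟩
              push_cast; ring
        _ ≤ N / Real.sqrt S.card + 1 / Real.sqrt S.card :=
            (prob_or_le _ _).trans (add_le_add ih (prob_sum_mem_Ico_le hc hw hS _))
        _ = _ := by push_cast; ring
  calc _ ≤ prob (fun x : Cube n => a ≤ ∑ i, w i * bitSign (x i) ∧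
        ∑ i, w i * bitSign (x i) < a + 2 * c * (⌊ℓ / (2 * c)⌋₊ + 1 : ℕ)) :=
        prob_mono fun x hx => ⟨hx.1, hx.2.trans_lt ?_⟩
    _ ≤ _ := key _
    _ ≤ _ := by
      gcongr
      push_cast
      gcongr
      exact Nat.floor_le (by positivity)
  have h := Nat.lt_floor_add_one (ℓ / (2 * c))
  rw [div_lt_iff₀ (by positivity)] at h
  push_cast
  linarith

theorem weight_eq_sum (x : Cube n) :
    (x.weight : ℝ) = n / 2 + ∑ i, 1 / 2 * bitSign (x i) := by
  have h : ∀ i, (if x i = true then (1 : ℝ) else 0) = 1 / 2 + 1 / 2 * bitSign (x i) := fun i => by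
    cases x i <;> norm_num [bitSign]
  rw [Cube.weight, Finset.card_filter]
  push_cast
  rw [Finset.sum_congr rfl fun i _ => h i, Finset.sum_add_distrib]
  simp [div_eq_mul_inv]

/-- A slab of the cube between two weights has small probability if it is thin. -/
theorem prob_weight_mem_Icc_le (hn : 1 ≤ n) (a : ℝ) {ℓ : ℝ} (hl : 0 ≤ ℓ) :
    prob (fun x : Cube n => a ≤ (x.weight : ℝ) ∧ (x.weight : ℝ) ≤ a + ℓ)
      ≤ (ℓ + 1) / Real.sqrt n := by
  have h := prob_sum_mem_Icc_le (n := n) (w := fun _ => 1 / 2) (S := Finset.univ) (c := 1 / 2)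
    (by norm_num) (fun _ _ => le_rfl) ⟨⟨0, hn⟩, Finset.mem_univ _⟩ (a - n / 2) hl
  simp only [Finset.card_univ, Fintype.card_fin] at h
  refine (prob_mono fun x hx => ?_).trans (h.trans_eq (by norm_num))
  rw [weight_eq_sum] at hx
  constructor <;> linarith [hx.1, hx.2]

/-! ### A lower bound for the probability of a thin slab next to the middle -/

theorem prob_card_filter_eq (D : Finset (Fin n)) (j : ℕ) :
    prob (fun r : Cube n => (D.filter fun i => r i = true).card = j)
      = (D.card.choose j : ℝ) / 2 ^ D.card := by
  rw [prob_cube_split D]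
  have h : ∀ b : {i // ¬ i ∈ D} → Bool, ∀ a : {i // i ∈ D} → Bool,
      (D.filter fun i => ((Equiv.piEquivPiSubtypeProd (fun i => i ∈ D)
        fun _ => Bool).symm (a, b)) i = true).card
      = (boolFunEquivFinset _ a).card := fun b a => by
    symm
    refine Finset.card_bij (fun i _ => (i : Fin n)) ?_ ?_ ?_
    · intro i hi
      simpa [boolFunEquivFinset, Equiv.piEquivPiSubtypeProd] using hi
    · intro i _ k _ hik
      exact Subtype.ext hik
    · intro i hi
      rw [Finset.mem_filter] at hi
      refine ⟨⟨i, hi.1⟩, ?_, rfl⟩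
      simpa [boolFunEquivFinset, Equiv.piEquivPiSubtypeProd, hi.1] using hi.2
  simp_rw [h]
  rw [Finset.expect_const (by simp)]
  rw [prob_equiv (boolFunEquivFinset {i // i ∈ D}) fun T => T.card = j,
    prob_eq_card_div, Fintype.card_finset, Finset.univ_filter_card_eq, Finset.card_powersetCard]
  simp

theorem choose_succ_le_of_le {d j : ℕ} (h : d ≤ 2 * j + 1) : d.choose (j + 1) ≤ d.choose j := by
  refine Nat.le_of_mul_le_mul_right ?_ (by omega : 0 < j + 1)
  rw [Nat.choose_succ_right_eq]
  exact Nat.mul_le_mul_left _ (by omega)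

theorem sum_range_mul_le_of_antitone {q : ℕ → ℝ} (hq : Antitone q) (B ℓ : ℕ) :
    ∑ t ∈ Finset.range (B * ℓ), q t ≤ B * ∑ t ∈ Finset.range ℓ, q t := by
  induction B with
  | zero => simp
  | succ B ih =>
    rw [Nat.succ_mul, Finset.sum_range_add]
    have h : ∑ t ∈ Finset.range ℓ, q (B * ℓ + t) ≤ ∑ t ∈ Finset.range ℓ, q t :=
      Finset.sum_le_sum fun t _ => hq (Nat.le_add_left _ _)
    push_cast
    linarith

theorem sum_bitSign_eq (D : Finset (Fin n)) (r : Cube n) :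
    ∑ i ∈ D, bitSign (r i) = 2 * (D.filter fun i => r i = true).card - D.card := by
  have h : ∀ i, bitSign (r i) = 2 * (if r i = true then (1 : ℝ) else 0) - 1 := fun i => by
    cases r i <;> norm_num [bitSign]
  rw [Finset.sum_congr rfl fun i _ => h i, Finset.card_filter]
  push_cast
  rw [Finset.sum_sub_distrib, Finset.mul_sum]
  simp

theorem prob_sum_bitSign_neg (D : Finset (Fin n)) (p : ℝ → Prop) :
    prob (fun r : Cube n => p (-∑ i ∈ D, bitSign (r i)))
      = prob fun r : Cube n => p (∑ i ∈ D, bitSign (r i)) := by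
  rw [← prob_equiv (complEquiv n)]
  simp [complEquiv, bitSign_not, Finset.sum_neg_distrib]

/-- By Chebyshev and symmetry. -/
theorem prob_sum_bitSign_nonneg_lt (hn : 1 ≤ n) (D : Finset (Fin n)) :
    3 / 8 ≤ prob fun r : Cube n =>
      0 ≤ ∑ i ∈ D, bitSign (r i) ∧ ∑ i ∈ D, bitSign (r i) < 2 * Real.sqrt n := by
  have hn' : (0 : ℝ) < n := by exact_mod_cast hn
  have hs : 0 < Real.sqrt n := Real.sqrt_pos.2 hn'
  have h1 : prob (fun r : Cube n => 2 * Real.sqrt n ≤ |∑ i ∈ D, bitSign (r i)|) ≤ 1 / 4 := by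
    have h := prob_le_abs_sum_bitSign D (fun _ => 1) (by simp)
      (by positivity : 0 < 2 * Real.sqrt n)
    simp only [one_mul] at h
    refine h.trans ?_
    rw [mul_pow, Real.sq_sqrt hn'.le, div_le_div_iff₀ (by positivity) (by norm_num)]
    have : (D.card : ℝ) ≤ n := by exact_mod_cast (Finset.card_le_univ D).trans_eq (by simp)
    linarith
  have h2 := prob_add_prob_not
    fun r : Cube n => 2 * Real.sqrt n ≤ |∑ i ∈ D, bitSign (r i)|
  have h3 : prob (fun r : Cube n => ¬ 2 * Real.sqrt n ≤ |∑ i ∈ D, bitSign (r i)|)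
      ≤ prob (fun r : Cube n =>
        (0 ≤ ∑ i ∈ D, bitSign (r i) ∧ ∑ i ∈ D, bitSign (r i) < 2 * Real.sqrt n) ∨
        (0 ≤ -∑ i ∈ D, bitSign (r i) ∧ -∑ i ∈ D, bitSign (r i) < 2 * Real.sqrt n)) := by
    refine prob_mono fun r hr => ?_
    have := abs_lt.1 (not_le.1 hr)
    rcases le_total 0 (∑ i ∈ D, bitSign (r i)) with h | h
    · exact Or.inl ⟨h, this.2⟩
    · exact Or.inr ⟨by linarith, by linarith⟩
  have h4 := h3.trans (prob_or_le _ _)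
  rw [prob_sum_bitSign_neg D fun t => 0 ≤ t ∧ t < 2 * Real.sqrt n] at h4
  linarith

/-- A random sign sum over at most `n` coordinates lands within `μ * √n` above its mean with
probability bounded below: the binomial weights decrease away from the middle, so that the
first of `B` consecutive blocks of equal length has the largest share. -/
theorem exists_le_prob_sum_bitSign {μ : ℝ} (hμ : 0 < μ) :
    ∃ p : ℝ, 0 < p ∧ ∀ n : ℕ, 2 / μ ≤ Real.sqrt n → ∀ D : Finset (Fin n),
      p ≤ prob fun r : Cube n => 0 ≤ 1 / 2 * ∑ i ∈ D, bitSign (r i) ∧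
        1 / 2 * ∑ i ∈ D, bitSign (r i) ≤ μ * Real.sqrt n := by
  obtain ⟨B, hB⟩ := exists_nat_ge (2 / μ)
  have hB0 : (0 : ℝ) < B := lt_of_lt_of_le (by positivity) hB
  refine ⟨3 / 8 / B, by positivity, fun n hn D => ?_⟩
  have hs : 0 < Real.sqrt n := lt_of_lt_of_le (by positivity) hn
  have hn1 : 1 ≤ n := Nat.one_le_iff_ne_zero.2 fun h => by simp [h] at hs
  have hμn : 2 ≤ μ * Real.sqrt n := by rwa [div_le_iff₀' hμ] at hn
  set ℓ := ⌊μ * Real.sqrt n⌋₊ with hℓ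
  have hℓ1 : (ℓ : ℝ) ≤ μ * Real.sqrt n := Nat.floor_le (by positivity)
  have hℓ2 : μ * Real.sqrt n < ℓ + 1 := Nat.lt_floor_add_one _
  have hBl : Real.sqrt n ≤ B * ℓ := by
    have : 2 / μ * (μ * Real.sqrt n / 2) ≤ B * ℓ := by gcongr; linarith
    calc Real.sqrt n = 2 / μ * (μ * Real.sqrt n / 2) := by field_simp
      _ ≤ _ := this
  set d := D.card
  set j₀ := (d + 1) / 2 with hj₀
  have hj1 : d ≤ 2 * j₀ := by omega
  have hj2 : 2 * j₀ ≤ d + 1 := by omega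
  have hj1' : (d : ℝ) ≤ 2 * j₀ := by exact_mod_cast hj1
  have hj2' : 2 * (j₀ : ℝ) ≤ d + 1 := by exact_mod_cast hj2
  let q : ℕ → ℝ := fun t => (d.choose (j₀ + t) : ℝ) / 2 ^ d
  have hq : Antitone q := antitone_nat_of_succ_le fun t => by
    have := choose_succ_le_of_le (d := d) (j := j₀ + t) (by omega)
    simp only [q]
    gcongr
    exact this
  have hsum : ∀ L : ℕ, ∑ t ∈ Finset.range L, q t = prob fun r : Cube n =>
      j₀ ≤ (D.filter fun i => r i = true).card ∧
        (D.filter fun i => r i = true).card < j₀ + L := fun L => by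
    simp_rw [q, d, ← prob_card_filter_eq D, prob]
    rw [← Finset.expect_sum_comm]
    refine Finset.expect_congr rfl fun r _ => ?_
    set c := (D.filter fun i => r i = true).card
    by_cases hc : j₀ ≤ c ∧ c < j₀ + L
    · rw [if_pos hc, Finset.sum_eq_single (c - j₀)]
      · rw [if_pos (by omega)]
      · exact fun t _ ht => if_neg (by omega)
      · intro h
        rw [Finset.mem_range] at h
        omega
    · rw [if_neg hc]
      refine Finset.sum_eq_zero fun t ht => if_neg ?_
      rw [Finset.mem_range] at ht
      omega
  have h1 := sum_range_mul_le_of_antitone hq B ℓ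
  have h2 : 3 / 8 ≤ ∑ t ∈ Finset.range (B * ℓ), q t := by
    rw [hsum]
    refine (prob_sum_bitSign_nonneg_lt hn1 D).trans (prob_mono fun r hr => ?_)
    rw [sum_bitSign_eq] at hr
    set c := (D.filter fun i => r i = true).card
    constructor
    · have : (d : ℝ) ≤ 2 * c := by linarith [hr.1]
      have : d ≤ 2 * c := by exact_mod_cast this
      omega
    · have : (c : ℝ) < j₀ + B * ℓ := by linarith [hr.2]
      exact_mod_cast this
  rw [div_le_iff₀' hB0]
  refine h2.trans (h1.trans ?_)
  gcongr
  rw [hsum]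
  refine prob_mono fun r hr => ?_
  rw [sum_bitSign_eq]
  set c := (D.filter fun i => r i = true).card
  have hc1 : (j₀ : ℝ) ≤ c := by exact_mod_cast hr.1
  have hc2 : (c : ℝ) + 1 ≤ j₀ + ℓ := by exact_mod_cast hr.2
  constructor <;> linarith

/-! ### Decision trees -/

namespace DTree

variable {f : Cube n → Bool} {M : Set (Cube n)}

theorem queriesIn_restrict (M : Set (Cube n)) (T : DTree n) : (T.restrict M).QueriesIn M := by
  induction T with
  | leaf b => trivial
  | query x t₀ t₁ h₀ h₁ =>
    rw [restrict]
    split_ifs with hx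
    · exact ⟨hx, h₀, h₁⟩
    · trivial

theorem depth_restrict_le (M : Set (Cube n)) (T : DTree n) : (T.restrict M).depth ≤ T.depth := by
  induction T with
  | leaf b => rfl
  | query x t₀ t₁ h₀ h₁ =>
    rw [restrict]
    split_ifs with hx
    · simp only [depth]
      omega
    · simp [depth]

theorem run_of_run_restrict {T : DTree n} (h : (T.restrict M).run f = false) :
    T.run f = false := by
  induction T with
  | leaf b => exact h
  | query x t₀ t₁ h₀ h₁ =>
    rw [restrict] at h
    split_ifs at h with hx
    · rw [run] at h ⊢
      split_ifs at h ⊢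
      · exact h₁ h
      · exact h₀ h
    · simp [run] at h

theorem run_restrict_of_run {T : DTree n} (h : T.run f = true) :
    (T.restrict M).run f = true := by
  by_contra h'
  rw [run_of_run_restrict (by simpa using h')] at h
  exact Bool.false_ne_true h

theorem run_restrict_query {x : Cube n} (hx : x ∈ M) (t₀ t₁ : DTree n) :
    ((query x t₀ t₁).restrict M).run f
      = if f x = true then (t₁.restrict M).run f else (t₀.restrict M).run f := by
  rw [restrict, if_pos hx, run]

theorem run_andThen (T T' : DTree n) : (T.andThen T').run f = (T.run f && T'.run f) := by
  induction T with
  | leaf b => cases b <;> simp [andThen, run]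
  | query x t₀ t₁ h₀ h₁ =>
    rw [andThen, run, run, h₀, h₁]
    split_ifs <;> rfl

theorem depth_andThen_le (T T' : DTree n) : (T.andThen T').depth ≤ T.depth + T'.depth := by
  induction T with
  | leaf b => cases b <;> simp [andThen, depth]
  | query x t₀ t₁ h₀ h₁ =>
    simp only [andThen, depth]
    omega

section QueryAll

variable (next : (Cube n → Bool) → DTree n)

theorem run_queryAll (l : List (Cube n)) (g : Cube n → Bool) :
    (queryAll next l g).run f = (next fun z => if z ∈ l then f z else g z).run f := by
  induction l generalizing g with
  | nil => simp [queryAll]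
  | cons x xs ih =>
    have h : ∀ b, f x = b → (fun z => if z ∈ xs then f z else Function.update g x b z)
        = fun z => if z ∈ x :: xs then f z else g z := fun b hb => by
      funext z
      by_cases hz : z ∈ xs
      · simp [hz]
      · by_cases hzx : z = x
        · subst hzx
          simp [hz, hb]
        · simp [hz, hzx]
    rw [queryAll, run, ih, ih]
    split_ifs with hx
    · rw [h _ hx]
    · rw [h _ (by simpa using hx)]

theorem restrict_queryAll {l : List (Cube n)} (hl : ∀ x ∈ l, x ∈ M) (g : Cube n → Bool) :
    (queryAll next l g).restrict M = queryAll (fun g => (next g).restrict M) l g := by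
  induction l generalizing g with
  | nil => rfl
  | cons x xs ih =>
    rw [queryAll, restrict, if_pos (hl x (by simp)), ih fun y hy => hl y (by simp [hy]),
      ih fun y hy => hl y (by simp [hy]), queryAll]

theorem depth_queryAll_le (h : ∀ g, (next g).depth = 0) (l : List (Cube n))
    (g : Cube n → Bool) : (queryAll next l g).depth ≤ l.length := by
  induction l generalizing g with
  | nil => simp [queryAll, h]
  | cons x xs ih =>
    simp only [queryAll, depth, List.length_cons]
    have := ih (Function.update g x false)
    have := ih (Function.update g x true)
    omega

end QueryAll

open Classical in
/-- The exhaustive test, which queries the whole cube. -/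
noncomputable def exhaustive (n : ℕ) : DTree n :=
  queryAll (fun g => leaf (decide (Monotone g))) Finset.univ.toList fun _ => false

theorem run_exhaustive : (exhaustive n).run f = true ↔ Monotone f := by
  classical
  simp [exhaustive, run_queryAll, run]

theorem depth_exhaustive_le (n : ℕ) : (exhaustive n).depth ≤ 2 ^ n := by
  refine (depth_queryAll_le _ (fun g => rfl) _ _).trans ?_
  simp

theorem queriesIn_exhaustive (hM : ∀ x, x ∈ M) (T : DTree n) : T.QueriesIn M := by
  induction T with
  | leaf b => trivial
  | query x t₀ t₁ h₀ h₁ => exact ⟨hM x, h₀, h₁⟩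

theorem card_hybrid_le (x y : Cube n) : (Cube.hybrid x y).card ≤ 2 ^ (Cube.diff x y).card := by
  rw [← Finset.card_powerset]
  refine Finset.card_le_card_of_injOn (fun z => Cube.diff x z) ?_ ?_
  · intro z hz
    rw [Finset.mem_coe, Finset.mem_powerset]
    intro i
    simp only [Cube.hybrid, Finset.coe_filter, Finset.mem_univ, true_and,
      Set.mem_ofPred_eq] at hz
    simp only [Cube.diff, Finset.mem_filter, Finset.mem_univ, true_and]
    exact fun h h' => h (hz i h').symm
  · intro z _ z' _ h
    funext i
    have := congrArg (fun S => i ∈ S) h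
    simp only [Cube.diff, Finset.mem_filter, Finset.mem_univ, true_and, eq_iff_iff] at this
    revert this
    cases x i <;> cases z i <;> cases z' i <;> simp

theorem run_finish_of_monotone (hf : Monotone f) (s : ℕ) (x y : Cube n) :
    (finish s x y).run f = true := by
  classical
  rw [finish]
  split_ifs with h
  · rfl
  · rw [run_queryAll, run, decide_eq_true_iff]
    intro u hu v hv huv _
    simpa [hu, hv] using hf huv

theorem depth_finish_le (s : ℕ) (x y : Cube n) : (finish s x y).depth ≤ 2 ^ s := by
  rw [finish]
  split_ifs with h
  · simp [depth]
  · refine (depth_queryAll_le _ (fun g => rfl) _ _).trans ?_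
    rw [Finset.length_toList]
    exact (card_hybrid_le x y).trans (Nat.pow_le_pow_right (by norm_num) (not_lt.1 h))

/-- A decreasing edge in a small subcube of points of `M` leads to rejection. -/
theorem run_restrict_finish {s : ℕ} {x y : Cube n} (hs : (Cube.diff x y).card ≤ s)
    (hM : ∀ z ∈ Cube.hybrid x y, z ∈ M) {u v : Cube n} (hu : u ∈ Cube.hybrid x y)
    (hv : v ∈ Cube.hybrid x y) (huv : u ≤ v) (hc : (Cube.diff u v).card = 1)
    (hfu : f u = true) (hfv : f v = false) : ((finish s x y).restrict M).run f = false := by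
  rw [finish, if_neg (not_lt.2 hs), restrict_queryAll _ (by simpa using hM), run_queryAll,
    restrict, run, decide_eq_false_iff_not]
  intro h
  have := h u hu v hv huv hc
  simp [hu, hv, hfu, hfv] at this
  exact absurd this (by decide)

theorem run_bisect_of_monotone (hf : Monotone f) (s : ℕ) (rs : List (Cube n)) (x y : Cube n) :
    (bisect s rs x y).run f = true := by
  induction rs generalizing x y with
  | nil => exact run_finish_of_monotone hf s x y
  | cons r rs ih => simp [bisect, run, ih]

theorem depth_bisect_le (s : ℕ) (rs : List (Cube n)) (x y : Cube n) :
    (bisect s rs x y).depth ≤ rs.length + 2 ^ s := by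
  induction rs generalizing x y with
  | nil => simpa [bisect] using depth_finish_le s x y
  | cons r rs ih =>
    simp only [bisect, depth, List.length_cons]
    have := ih (Cube.mix r x y) y
    have := ih x (Cube.mix r x y)
    omega

theorem run_search_of_monotone (hf : Monotone f) (s : ℕ) (rs : List (Cube n)) (x : Cube n)
    (b : Bool) (ys : List (Cube n)) : (search s rs x b ys).run f = true := by
  induction ys with
  | nil => rfl
  | cons y ys ih =>
    rw [search]
    split_ifs <;> simp [run, ih, run_bisect_of_monotone hf]

theorem depth_search_le (s : ℕ) (rs : List (Cube n)) (x : Cube n) (b : Bool)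
    (ys : List (Cube n)) : (search s rs x b ys).depth ≤ ys.length + rs.length + 2 ^ s := by
  induction ys with
  | nil => simp [search, depth]
  | cons y ys ih =>
    have := depth_bisect_le s rs x y
    have := depth_bisect_le s rs y x
    rw [search]
    split_ifs <;> simp only [depth, List.length_cons] <;> omega

theorem run_bisection_of_monotone (hf : Monotone f) (s : ℕ) (x : Cube n)
    (ys rs : List (Cube n)) : (bisection s x ys rs).run f = true := by
  simp [bisection, run, run_search_of_monotone hf]

theorem depth_bisection_le (s : ℕ) (x : Cube n) (ys rs : List (Cube n)) :
    (bisection s x ys rs).depth ≤ 1 + ys.length + rs.length + 2 ^ s := by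
  have := depth_search_le s rs x false ys
  have := depth_search_le s rs x true ys
  simp only [bisection, depth]
  omega

end DTree

/-! ### Randomized algorithms -/

namespace RandAlg

variable {f : Cube n → Bool}

theorem rejectProb_map_uniform {Ω : Type*} [Fintype Ω] [Nonempty Ω] (g : Ω → DTree n) :
    rejectProb ((PMF.uniformOfFintype Ω).map g) f
      = ENNReal.ofReal (prob fun c => (g c).run f = false) := by
  classical
  rw [rejectProb, PMF.map_comp, PMF.map_apply, tsum_fintype, prob_eq_card_div,
    ENNReal.ofReal_div_of_pos (by exact_mod_cast Fintype.card_pos), ENNReal.ofReal_natCast,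
    ENNReal.ofReal_natCast]
  simp only [Function.comp, PMF.uniformOfFintype_apply, eq_comm (a := false)]
  rw [← Finset.sum_filter, Finset.sum_const, nsmul_eq_mul, div_eq_mul_inv]

theorem exists_of_mem_support_bisection {m k s : ℕ} {T : DTree n}
    (hT : T ∈ (bisection n m k s).support) : ∃ (x : Cube n) (ys rs : List (Cube n)),
      ys.length = m ∧ rs.length = k ∧ T = DTree.bisection s x ys rs := by
  rw [bisection, PMF.mem_support_map_iff] at hT
  obtain ⟨c, -, rfl⟩ := hT
  exact ⟨c.1, List.ofFn c.2.1, List.ofFn c.2.2, by simp, by simp, rfl⟩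

theorem exists_of_mem_support_restrict {A : RandAlg n} {M : Set (Cube n)} {T : DTree n}
    (hT : T ∈ (A.restrict M).support) : ∃ T' ∈ A.support, T = T'.restrict M := by
  rw [restrict, PMF.mem_support_map_iff] at hT
  obtain ⟨T', h, rfl⟩ := hT
  exact ⟨T', h, rfl⟩

theorem queriesIn_restrict (A : RandAlg n) (M : Set (Cube n)) : (A.restrict M).QueriesIn M := by
  intro T hT
  obtain ⟨T', -, rfl⟩ := exists_of_mem_support_restrict hT
  exact T'.queriesIn_restrict M

theorem QueriesAtMost.restrict {A : RandAlg n} {q : ℝ} (h : A.QueriesAtMost q)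
    (M : Set (Cube n)) : (A.restrict M).QueriesAtMost q := by
  intro T hT
  obtain ⟨T', hT', rfl⟩ := exists_of_mem_support_restrict hT
  exact le_trans (by exact_mod_cast T'.depth_restrict_le M) (h T' hT')

theorem AlwaysAccepts.restrict {A : RandAlg n} (h : A.AlwaysAccepts f) (M : Set (Cube n)) :
    (A.restrict M).AlwaysAccepts f := by
  intro T hT
  obtain ⟨T', hT', rfl⟩ := exists_of_mem_support_restrict hT
  exact DTree.run_restrict_of_run (h T' hT')

theorem queriesAtMost_bisection (n m k s : ℕ) :
    (bisection n m k s).QueriesAtMost ((1 + m + k + 2 ^ s : ℕ) : ℝ) := by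
  intro T hT
  obtain ⟨x, ys, rs, hy, hr, rfl⟩ := exists_of_mem_support_bisection hT
  have := DTree.depth_bisection_le s x ys rs
  rw [hy, hr] at this
  exact_mod_cast this

theorem alwaysAccepts_bisection (hf : Monotone f) (m k s : ℕ) :
    (bisection n m k s).AlwaysAccepts f := by
  intro T hT
  obtain ⟨x, ys, rs, -, -, rfl⟩ := exists_of_mem_support_bisection hT
  exact DTree.run_bisection_of_monotone hf s x ys rs

theorem exists_of_mem_support_runs_succ {A : RandAlg n} {R : ℕ} {T : DTree n}
    (hT : T ∈ (A.runs (R + 1)).support) :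
    ∃ T₁ ∈ A.support, ∃ T₂ ∈ (A.runs R).support, T = T₁.andThen T₂ := by
  rw [runs, PMF.mem_support_bind_iff] at hT
  obtain ⟨T₁, h₁, hT⟩ := hT
  rw [PMF.mem_support_map_iff] at hT
  obtain ⟨T₂, h₂, rfl⟩ := hT
  exact ⟨T₁, h₁, T₂, h₂, rfl⟩

theorem QueriesAtMost.runs {A : RandAlg n} {q : ℝ} (h : A.QueriesAtMost q) (R : ℕ) :
    (A.runs R).QueriesAtMost (R * q) := by
  induction R with
  | zero =>
    intro T hT
    rw [RandAlg.runs, PMF.mem_support_pure_iff] at hT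
    simp [hT, DTree.depth]
  | succ R ih =>
    intro T hT
    obtain ⟨T₁, h₁, T₂, h₂, rfl⟩ := exists_of_mem_support_runs_succ hT
    have h3 : ((T₁.andThen T₂).depth : ℝ) ≤ T₁.depth + T₂.depth := by
      exact_mod_cast DTree.depth_andThen_le T₁ T₂
    have := h T₁ h₁
    have := ih T₂ h₂
    push_cast
    linarith

theorem AlwaysAccepts.runs {A : RandAlg n} (h : A.AlwaysAccepts f) (R : ℕ) :
    (A.runs R).AlwaysAccepts f := by
  induction R with
  | zero =>
    intro T hT
    rw [RandAlg.runs, PMF.mem_support_pure_iff] at hT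
    rw [hT, DTree.run]
  | succ R ih =>
    intro T hT
    obtain ⟨T₁, h₁, T₂, h₂, rfl⟩ := exists_of_mem_support_runs_succ hT
    rw [DTree.run_andThen, h T₁ h₁, ih T₂ h₂, Bool.and_true]

theorem map_run_runs_true (A : RandAlg n) (R : ℕ) :
    ((A.runs R).map fun T => T.run f) true = ((A.map fun T => T.run f) true) ^ R := by
  induction R with
  | zero => simp [runs, PMF.pure_map, DTree.run]
  | succ R ih =>
    rw [runs, PMF.map_bind, PMF.bind_apply, pow_succ', ← ih, PMF.map_apply,
      ← ENNReal.tsum_mul_right]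
    refine tsum_congr fun T => ?_
    rw [PMF.map_comp]
    simp only [Function.comp_def, DTree.run_andThen]
    cases hT : T.run f
    · simp [PMF.map_apply]
    · simp

theorem map_run_add (A : RandAlg n) :
    ((A.map fun T => T.run f) true) + A.rejectProb f = 1 := by
  have h := (A.map fun T => T.run f).tsum_coe
  rwa [tsum_bool, add_comm] at h

/-- If one run rejects with probability at least `p`, then `R` independent runs all accept with
probability at most `(1 - p) ^ R`. -/
theorem half_le_rejectProb_runs {A : RandAlg n} {R : ℕ} {p : ℝ} (hp : p ≤ 1)
    (hA : ENNReal.ofReal p ≤ A.rejectProb f) (hR : (1 - p) ^ R ≤ 1 / 2) :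
    1 / 2 ≤ (A.runs R).rejectProb f := by
  have h1 : ((A.map fun T => T.run f) true) ≤ ENNReal.ofReal (1 - p) := by
    have h := map_run_add (f := f) A
    by_cases hp0 : 0 ≤ p
    · rw [ENNReal.ofReal_sub _ hp0, ENNReal.ofReal_one, ← h]
      refine ENNReal.le_sub_of_add_le_right ENNReal.ofReal_ne_top ?_
      gcongr
    · refine (le_add_right le_rfl).trans (h.le.trans ?_)
      rw [← ENNReal.ofReal_one]
      exact ENNReal.ofReal_le_ofReal (by linarith)
  have h2 : ((A.runs R).map fun T => T.run f) true ≤ 1 / 2 := by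
    rw [map_run_runs_true]
    calc _ ≤ ENNReal.ofReal (1 - p) ^ R := by gcongr
      _ = ENNReal.ofReal ((1 - p) ^ R) := (ENNReal.ofReal_pow (by linarith) R).symm
      _ ≤ ENNReal.ofReal (1 / 2) := ENNReal.ofReal_le_ofReal hR
      _ = 1 / 2 := by rw [ENNReal.ofReal_div_of_pos (by norm_num)]; simp
  have h3 := map_run_add (f := f) (A.runs R)
  by_contra h
  have h4 := ENNReal.add_lt_add_of_le_of_lt (ne_top_of_le_ne_top (by simp) h2) h2 (not_le.1 h)
  rw [h3, ENNReal.add_halves] at h4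
  exact lt_irrefl _ h4

end RandAlg

/-! ### Linear threshold functions -/

theorem IsFarFromMonotone.le_prob {ε : ℝ} {f g : Cube n → Bool} (hf : IsFarFromMonotone ε f)
    (hg : Monotone g) : ε ≤ prob fun x => f x ≠ g x := by
  rw [prob_eq_card_div, le_div_iff₀ (by exact_mod_cast Fintype.card_pos)]
  simpa using hf g hg

theorem monotone_bitSign : Monotone bitSign := by
  intro a b h
  revert h
  cases a <;> cases b <;> simp [bitSign]

/-- A threshold function of nonnegative weights is monotone. -/
theorem monotone_threshold {w : Fin n → ℝ} (hw : ∀ i, 0 ≤ w i) (θ : ℝ) :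
    Monotone fun x : Cube n => decide (θ ≤ ∑ i, w i * bitSign (x i)) := by
  intro x y hxy
  refine Bool.le_iff_imp.2 fun h => ?_
  rw [decide_eq_true_iff] at h ⊢
  exact h.trans (Finset.sum_le_sum fun i _ =>
    mul_le_mul_of_nonneg_left (monotone_bitSign (hxy i)) (hw i))

/-- The coordinates whose weight is negative and at least a `c / √n` fraction of the Euclidean
norm of the weight vector. -/
noncomputable def negativeWeights (c : ℝ) (w : Fin n → ℝ) : Finset (Fin n) :=
  Finset.univ.filter fun i => w i ≤ -(c / Real.sqrt n * Real.sqrt (∑ j, w j ^ 2))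

/-- If few coordinates have a sizable negative weight, then the negative parts of the weights
have a small sum of squares. -/
theorem sum_min_sq_le (hn : 1 ≤ n) {c τ : ℝ} (hc : 0 < c) {w : Fin n → ℝ}
    (hw : ∀ i, |w i| ≤ τ / Real.sqrt n * Real.sqrt (∑ j, w j ^ 2))
    (hN : ((negativeWeights c w).card : ℝ) ≤ c * n) :
    ∑ i, min (w i) 0 ^ 2 ≤ (c * τ ^ 2 + c ^ 2) * ∑ j, w j ^ 2 := by
  have hn' : (0 : ℝ) < n := by exact_mod_cast hn
  set Q := ∑ j, w j ^ 2 with hQ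
  have hQ0 : 0 ≤ Q := Finset.sum_nonneg fun i _ => sq_nonneg _
  have hsq : ∀ a : ℝ, (a / Real.sqrt n * Real.sqrt Q) ^ 2 = a ^ 2 * Q / n := fun a => by
    rw [mul_pow, div_pow, Real.sq_sqrt hn'.le, Real.sq_sqrt hQ0]
    ring
  have h1 : ∀ i, min (w i) 0 ^ 2
      ≤ (if i ∈ negativeWeights c w then τ ^ 2 * Q / n else 0) + c ^ 2 * Q / n := fun i => by
    split_ifs with hi
    · have h2 : min (w i) 0 ^ 2 ≤ w i ^ 2 := by
        rcases min_cases (w i) 0 with h | h <;> rw [h.1]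
        simpa using sq_nonneg (w i)
      have h3 : w i ^ 2 ≤ τ ^ 2 * Q / n := by
        rw [← hsq, ← sq_abs (w i)]
        exact pow_le_pow_left₀ (abs_nonneg _) (hw i) 2
      have : 0 ≤ c ^ 2 * Q / n := by positivity
      linarith
    · simp only [negativeWeights, Finset.mem_filter, Finset.mem_univ, true_and, not_le] at hi
      rw [zero_add, ← hsq]
      refine sq_le_sq.2 ?_
      rw [abs_of_nonpos (min_le_right _ _), abs_of_nonneg (by positivity)]
      rcases min_cases (w i) 0 with h | h <;> rw [h.1]
      · linarith
      · rw [neg_zero]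
        positivity
  refine (Finset.sum_le_sum fun i _ => h1 i).trans ?_
  rw [Finset.sum_add_distrib, Finset.sum_ite_mem, Finset.univ_inter, Finset.sum_const,
    Finset.sum_const, Finset.card_univ, Fintype.card_fin, nsmul_eq_mul, nsmul_eq_mul]
  calc _ ≤ c * n * (τ ^ 2 * Q / n) + n * (c ^ 2 * Q / n) := by gcongr
    _ = _ := by field_simp

/-- If the positive parts of regular weights carry half of the sum of squares, then many of
them are large. -/
theorem div_le_card_large (hn : 1 ≤ n) {τ : ℝ} (hτ : 0 < τ) {w : Fin n → ℝ}
    (hQ : 0 < ∑ j, w j ^ 2)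
    (hw : ∀ i, |w i| ≤ τ / Real.sqrt n * Real.sqrt (∑ j, w j ^ 2))
    (hu : (∑ j, w j ^ 2) / 2 ≤ ∑ i, max (w i) 0 ^ 2) :
    n / (4 * τ ^ 2) ≤ ((Finset.univ.filter fun i =>
      Real.sqrt (∑ j, w j ^ 2) / (2 * Real.sqrt n) ≤ max (w i) 0).card : ℝ) := by
  have hn' : (0 : ℝ) < n := by exact_mod_cast hn
  set Q := ∑ j, w j ^ 2
  set S := Finset.univ.filter fun i => Real.sqrt Q / (2 * Real.sqrt n) ≤ max (w i) 0 with hS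
  have h1 : ∀ i, max (w i) 0 ^ 2 ≤ (if i ∈ S then τ ^ 2 * Q / n else 0) + Q / (4 * n) :=
      fun i => by
    have hm : 0 ≤ max (w i) 0 := le_max_right _ _
    split_ifs with hi
    · have h2 : max (w i) 0 ≤ τ / Real.sqrt n * Real.sqrt Q :=
        max_le ((le_abs_self _).trans (hw i)) (by positivity)
      have h3 := pow_le_pow_left₀ hm h2 2
      rw [mul_pow, div_pow, Real.sq_sqrt hn'.le, Real.sq_sqrt hQ.le] at h3
      have : 0 ≤ Q / (4 * n) := by positivity
      have : τ ^ 2 / n * Q = τ ^ 2 * Q / n := by ring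
      linarith
    · rw [hS, Finset.mem_filter] at hi
      simp only [Finset.mem_univ, true_and, not_le] at hi
      have h3 := pow_le_pow_left₀ hm hi.le 2
      rw [div_pow, mul_pow, Real.sq_sqrt hn'.le, Real.sq_sqrt hQ.le] at h3
      norm_num at h3
      linarith
  have h2 := hu.trans (Finset.sum_le_sum fun i _ => h1 i)
  rw [Finset.sum_add_distrib, Finset.sum_ite_mem, Finset.univ_inter, Finset.sum_const,
    Finset.sum_const, Finset.card_univ, Fintype.card_fin, nsmul_eq_mul, nsmul_eq_mul,
    show (n : ℝ) * (Q / (4 * n)) = Q / 4 by field_simp] at h2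
  rw [div_le_iff₀ (by positivity)]
  have h3 : Q / 4 ≤ S.card * (τ ^ 2 * Q / n) := by linarith
  rw [show (S.card : ℝ) * (τ ^ 2 * Q / n) = (S.card * τ ^ 2 / n) * Q by ring,
    show Q / 4 = 1 / 4 * Q by ring] at h3
  have h4 := le_of_mul_le_mul_right h3 hQ
  rw [le_div_iff₀ hn'] at h4
  linarith

/-- A regular threshold function that is far from monotone has linearly many sizable negative
weights. Otherwise dropping the negative weights changes it on few points only: their
contribution is small by Chebyshev, while the positive part is rarely that close to the
threshold by Littlewood–Offord. -/
theorem exists_le_card_negativeWeights {ε τ : ℝ} (hε : 0 < ε) (hτ : 0 < τ) :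
    ∃ c : ℝ, 0 < c ∧ ∃ n₁ : ℕ, ∀ n : ℕ, n₁ ≤ n → ∀ (f : Cube n → Bool) (w : Fin n → ℝ) (θ : ℝ),
      IsLTFWith f w θ → (∀ i, |w i| ≤ τ / Real.sqrt n * Real.sqrt (∑ j, w j ^ 2)) →
      IsFarFromMonotone ε f → c * n ≤ (negativeWeights c w).card := by
  set t : ℝ := ε / (16 * τ) with ht
  have ht0 : 0 < t := by positivity
  set e : ℝ := min (1 / 2) (ε * t ^ 2 / 4) with he
  have he0 : 0 < e := by positivity
  set c : ℝ := min 1 (e / (τ ^ 2 + 1)) with hc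
  have hc0 : 0 < c := by positivity
  have hce : c * τ ^ 2 + c ^ 2 ≤ e := by
    have h1 : c ≤ 1 := min_le_left _ _
    have h2 : c ≤ e / (τ ^ 2 + 1) := min_le_right _ _
    rw [le_div_iff₀ (by positivity)] at h2
    nlinarith
  obtain ⟨n₁, hn₁⟩ := exists_nat_ge (max 1 ((16 * τ / ε) ^ 2))
  refine ⟨c, hc0, n₁, fun n hn f w θ hf hw hfar => ?_⟩
  have hn1 : 1 ≤ n := by
    have : (1 : ℝ) ≤ n := (le_max_left _ _).trans (hn₁.trans (by exact_mod_cast hn))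
    exact_mod_cast this
  have hn' : (0 : ℝ) < n := by exact_mod_cast hn1
  have hs0 : 0 < Real.sqrt n := Real.sqrt_pos.2 hn'
  have hs : 16 * τ / ε ≤ Real.sqrt n :=
    Real.le_sqrt_of_sq_le ((le_max_right _ _).trans (hn₁.trans (by exact_mod_cast hn)))
  by_contra hN
  rw [not_le] at hN
  set Q := ∑ j, w j ^ 2 with hQdef
  have hQ0 : 0 ≤ Q := Finset.sum_nonneg fun i _ => sq_nonneg _
  -- If all weights vanish, then every coordinate counts as a negative one.
  have hQ : 0 < Q := by
    refine lt_of_le_of_ne hQ0 fun h => ?_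
    have hw0 : ∀ i, w i ≤ 0 := fun i => by
      have := hw i
      rw [← h, Real.sqrt_zero, mul_zero] at this
      exact (le_abs_self _).trans this
    have : negativeWeights c w = Finset.univ := by
      ext i
      simp [negativeWeights, ← hQdef, ← h, hw0 i]
    rw [this, Finset.card_univ, Fintype.card_fin] at hN
    have : c ≤ 1 := min_le_left _ _
    nlinarith
  set σ := Real.sqrt Q with hσ
  have hσ0 : 0 < σ := Real.sqrt_pos.2 hQ
  have hσ2 : σ ^ 2 = Q := Real.sq_sqrt hQ.le
  have hv : ∑ i, min (w i) 0 ^ 2 ≤ e * Q :=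
    (sum_min_sq_le hn1 hc0 hw hN.le).trans (mul_le_mul_of_nonneg_right hce hQ0)
  have hu : Q / 2 ≤ ∑ i, max (w i) 0 ^ 2 := by
    have h1 : Q = ∑ i, max (w i) 0 ^ 2 + ∑ i, min (w i) 0 ^ 2 := by
      rw [← Finset.sum_add_distrib]
      refine Finset.sum_congr rfl fun i _ => ?_
      rcases le_total (w i) 0 with h | h <;> simp [h]
    have : e ≤ 1 / 2 := min_le_left _ _
    nlinarith
  have hS := div_le_card_large hn1 hτ hQ hw hu
  set S := Finset.univ.filter fun i => σ / (2 * Real.sqrt n) ≤ max (w i) 0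
  have hSne : S.Nonempty := by
    rw [← Finset.card_pos]
    have : (0 : ℝ) < S.card := lt_of_lt_of_le (by positivity) hS
    exact_mod_cast this
  have hSs : Real.sqrt n / (2 * τ) ≤ Real.sqrt S.card := by
    refine Real.le_sqrt_of_sq_le (le_of_eq_of_le ?_ hS)
    rw [div_pow, mul_pow, Real.sq_sqrt hn'.le]
    norm_num
  have hfar' := hfar.le_prob (monotone_threshold (fun i => le_max_right (w i) 0) θ)
  have hsplit : prob (fun x : Cube n =>
        f x ≠ decide (θ ≤ ∑ i, max (w i) 0 * bitSign (x i))) ≤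
      prob (fun x : Cube n => t * σ ≤ |∑ i, min (w i) 0 * bitSign (x i)|) +
      prob (fun x : Cube n => θ - t * σ ≤ ∑ i, max (w i) 0 * bitSign (x i) ∧
        ∑ i, max (w i) 0 * bitSign (x i) ≤ θ - t * σ + 2 * (t * σ)) := by
    refine (prob_mono fun x hx => ?_).trans (prob_or_le _ _)
    by_contra hcon
    push Not at hcon
    obtain ⟨h1, h2⟩ := hcon
    rw [abs_lt] at h1
    have hsum : ∑ i, w i * bitSign (x i) = ∑ i, max (w i) 0 * bitSign (x i)
        + ∑ i, min (w i) 0 * bitSign (x i) := by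
      rw [← Finset.sum_add_distrib]
      refine Finset.sum_congr rfl fun i _ => ?_
      rcases le_total (w i) 0 with h | h <;> simp [h]
    refine hx (Bool.eq_iff_iff.2 ?_)
    rw [hf x, hsum, decide_eq_true_iff]
    constructor
    · intro h
      by_contra h'
      have := h2 (by linarith)
      linarith
    · intro h
      have := h2 (by linarith)
      linarith
  have hcheb : prob (fun x : Cube n => t * σ ≤ |∑ i, min (w i) 0 * bitSign (x i)|) ≤ ε / 4 := by
    refine (prob_le_abs_le _ (by positivity)
      ((expect_sum_bitSign_sq fun i => min (w i) 0).trans_le hv)).trans ?_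
    rw [div_le_iff₀ (by positivity), mul_pow, hσ2]
    have : e ≤ ε * t ^ 2 / 4 := min_le_right _ _
    nlinarith
  have hLO := prob_sum_mem_Icc_le (w := fun i => max (w i) 0) (S := S)
    (c := σ / (2 * Real.sqrt n)) (by positivity) (fun i hi => (Finset.mem_filter.1 hi).2) hSne
    (θ - t * σ) (ℓ := 2 * (t * σ)) (by positivity)
  have hLO' : (2 * (t * σ) / (2 * (σ / (2 * Real.sqrt n))) + 1) / Real.sqrt S.card
      ≤ 3 * ε / 8 := by
    calc _ ≤ (2 * (t * σ) / (2 * (σ / (2 * Real.sqrt n))) + 1) / (Real.sqrt n / (2 * τ)) := by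
          gcongr
      _ = 4 * τ * t + 2 * τ / Real.sqrt n := by field_simp; ring
      _ ≤ ε / 4 + ε / 8 := by
          refine add_le_add ?_ ?_
          · rw [ht]
            apply le_of_eq
            field_simp
            norm_num
          · rw [div_le_iff₀ hs0]
            rw [div_le_iff₀ hε] at hs
            linarith
      _ = _ := by ring
  linarith

/-! ### Decreasing edges in a subcube -/

/-- If `f` does not depend on the coordinates in `F` over a subcube in which they are free, then
these coordinates may be overwritten all at once. -/
theorem apply_piecewise_eq {f : Cube n → Bool} {H : Cube n → Prop} {F : Finset (Fin n)}
    (hH : ∀ u, H u → ∀ i ∈ F, ∀ b, H (Function.update u i b))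
    (hf : ∀ u, H u → ∀ i ∈ F, ∀ b, f (Function.update u i b) = f u) (v : Cube n) {u : Cube n}
    (hu : H u) : f (F.piecewise v u) = f u := by
  have key : ∀ G ⊆ F, H (G.piecewise v u) ∧ f (G.piecewise v u) = f u := fun G => by
    induction G using Finset.induction with
    | empty => simpa using hu
    | insert i G hi ih =>
      intro hG
      obtain ⟨h1, h2⟩ := ih ((Finset.subset_insert _ _).trans hG)
      have hiF := hG (Finset.mem_insert_self _ _)
      rw [Finset.piecewise_insert]
      exact ⟨hH _ h1 i hiF _, (hf _ h1 i hiF _).trans h2⟩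
  exact (key F subset_rfl).2

theorem diff_update (u : Cube n) (i : Fin n) :
    Cube.diff (Function.update u i false) (Function.update u i true) = {i} := by
  ext j
  by_cases h : j = i
  · subst h
    simp [Cube.diff]
  · simp [Cube.diff, h]

/-- Suppose that a threshold function takes both values on a subcube, and that the nonpositive
weights at a set `E` of free coordinates together outweigh each positive weight at a free
coordinate. Then it decreases along an edge of the subcube. Otherwise it does not depend on the
free coordinates of nonpositive weight. It then does not depend on the other ones either: a step
across the threshold in such a coordinate could be replaced by steps in `E`. -/
theorem IsLTFWith.exists_decreasing_edge {f : Cube n → Bool} {w : Fin n → ℝ} {θ : ℝ}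
    (hf : IsLTFWith f w θ) {x y : Cube n} (hx : f x = false) (hy : f y = true)
    {E : Finset (Fin n)} (hE : E ⊆ Cube.diff x y) (hneg : ∀ i ∈ E, w i ≤ 0)
    (hsum : ∀ j, w j ≤ ∑ i ∈ E, -w i) :
    ∃ u ∈ Cube.hybrid x y, ∃ v ∈ Cube.hybrid x y, u ≤ v ∧ (Cube.diff u v).card = 1 ∧
      f u = true ∧ f v = false := by
  by_contra hno
  push Not at hno
  have hH : ∀ u, u ∈ Cube.hybrid x y → ∀ i ∈ Cube.diff x y, ∀ b,
      Function.update u i b ∈ Cube.hybrid x y := fun u hu i hi b => by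
    simp only [Cube.hybrid, Cube.diff, Finset.mem_filter, Finset.mem_univ, true_and]
      at hu hi ⊢
    intro j hj
    have hji : j ≠ i := fun h => hi (h ▸ hj)
    simpa [hji] using hu j hj
  have hedge : ∀ u ∈ Cube.hybrid x y, ∀ i ∈ Cube.diff x y,
      f (Function.update u i false) = true → f (Function.update u i true) = true :=
    fun u hu i hi h => by
    have := hno _ (hH u hu i hi false) _ (hH u hu i hi true)
      (update_le_update_iff.2 ⟨Bool.false_le _, fun _ _ => le_rfl⟩)
      (by rw [diff_update, Finset.card_singleton]) h
    simpa using this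
  have hval : ∀ u (i : Fin n), ∑ j, w j * bitSign (Function.update u i true j)
      = ∑ j, w j * bitSign (Function.update u i false j) + 2 * w i := fun u i => by
    rw [← Fintype.sum_ite_eq' i fun j => 2 * w j, ← Finset.sum_add_distrib]
    refine Finset.sum_congr rfl fun j _ => ?_
    by_cases h : j = i
    · subst h
      simp [bitSign]
      ring
    · simp [h]
  have hboth : ∀ u (i : Fin n),
      f (Function.update u i true) = f (Function.update u i false) →
      ∀ b, f (Function.update u i b) = f u := fun u i h b => by
    conv_rhs => rw [← Function.update_eq_self i u]
    cases b <;> cases u i <;> simp [h]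
  have hinv : ∀ u, u ∈ Cube.hybrid x y → ∀ i ∈ Cube.diff x y, w i ≤ 0 → ∀ b,
      f (Function.update u i b) = f u := fun u hu i hi hwi => by
    refine hboth u i (Bool.eq_iff_iff.2 ⟨fun h => ?_, hedge u hu i hi⟩)
    rw [hf, hval] at h
    rw [hf]
    linarith
  have hpos : ∀ u, u ∈ Cube.hybrid x y → ∀ j ∈ Cube.diff x y, 0 < w j → ∀ b,
      f (Function.update u j b) = f u := fun u hu j hj hwj => by
    refine hboth u j (Bool.eq_iff_iff.2 ⟨fun h => ?_, fun h => ?_⟩)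
    · by_contra h'
      have hjE : j ∉ E := fun h => absurd (hneg j h) (not_le.2 hwj)
      have hpw : ∀ v b, f (E.piecewise v (Function.update u j b)) = f (Function.update u j b) :=
        fun v b => apply_piecewise_eq (H := fun u => u ∈ Cube.hybrid x y)
          (fun u hu i hi => hH u hu i (hE hi))
          (fun u hu i hi => hinv u hu i (hE hi) (hneg i hi)) v (hH u hu j hj b)
      have h1 : f (E.piecewise (fun _ => true) (Function.update u j true)) = true := by
        rw [hpw, h]
      rw [← hpw fun _ => false] at h'
      rw [hf] at h1 h'
      apply h'
      refine h1.trans ?_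
      have e1 : ∑ i, w i * bitSign (E.piecewise (fun _ => true) (Function.update u j true) i)
          = ∑ i, w i * bitSign (E.piecewise (fun _ => false) (Function.update u j false) i)
            + 2 * w j - ∑ i ∈ E, 2 * -w i := by
        rw [← Fintype.sum_ite_eq' j fun i => 2 * w i, ← Finset.univ_inter E,
          ← Finset.sum_ite_mem, ← Finset.sum_add_distrib, ← Finset.sum_sub_distrib]
        refine Finset.sum_congr rfl fun i _ => ?_
        by_cases hi : i ∈ E
        · have : i ≠ j := fun h => hjE (h ▸ hi)
          simp [hi, this, bitSign]
          ring
        · by_cases hij : i = j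
          · subst hij
            simp [hi, bitSign]
            ring
          · simp [hi, hij]
      rw [e1, ← Finset.mul_sum]
      linarith [hsum j]
    · rw [hf] at h ⊢
      rw [hval]
      linarith
  have hall := apply_piecewise_eq (f := f) (H := fun u => u ∈ Cube.hybrid x y) hH
    (fun u hu i hi => (le_or_gt (w i) 0).elim (hinv u hu i hi) (hpos u hu i hi)) y
    (u := x) (by simp [Cube.hybrid])
  have hxy : (Cube.diff x y).piecewise y x = y := by
    funext i
    by_cases h : x i = y i <;> simp [Cube.diff, h, Finset.piecewise]
  rw [hxy, hx, hy] at hall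
  exact Bool.false_ne_true hall.symm

/-! ### One step of the bisection -/

theorem mem_middleLayers_iff {δ : ℝ} {x : Cube n} :
    x ∈ middleLayers n δ ↔ |(x.weight : ℝ) - n / 2| ≤ δ * Real.sqrt n := by
  rw [abs_le, middleLayers, Set.mem_ofPred_eq]
  constructor <;> rintro ⟨h1, h2⟩ <;> constructor <;> linarith

theorem card_filter_ne_eq (S : Finset (Fin n)) (x r : Cube n) :
    ((S.filter fun i => r i ≠ x i).card : ℝ)
      = S.card / 2 - 1 / 2 * ∑ i ∈ S, bitSign (x i) * bitSign (r i) := by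
  have h : ∀ i, (if r i ≠ x i then (1 : ℝ) else 0)
      = 1 / 2 - 1 / 2 * (bitSign (x i) * bitSign (r i)) := fun i => by
    cases r i <;> cases x i <;> norm_num [bitSign]
  rw [Finset.card_filter]
  push_cast
  rw [Finset.sum_congr rfl fun i _ => h i, Finset.sum_sub_distrib, Finset.mul_sum]
  simp [div_eq_mul_inv]

theorem mem_diff {x y : Cube n} {i : Fin n} : i ∈ Cube.diff x y ↔ x i ≠ y i := by
  simp [Cube.diff]

theorem diff_mix_inter (r x y : Cube n) (S : Finset (Fin n)) :
    Cube.diff x (Cube.mix r x y) ∩ S = (Cube.diff x y ∩ S).filter fun i => r i ≠ x i := by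
  ext i
  by_cases h : x i = y i <;> simp [mem_diff, Cube.mix, h, eq_comm, and_comm]

theorem mix_diff_inter (r x y : Cube n) (S : Finset (Fin n)) :
    Cube.diff (Cube.mix r x y) y ∩ S = (Cube.diff x y ∩ S).filter fun i => r i ≠ y i := by
  ext i
  by_cases h : x i = y i <;> simp [mem_diff, Cube.mix, h, and_comm]

theorem sum_diff_inter_neg (r x y : Cube n) (S : Finset (Fin n)) :
    ∑ i ∈ Cube.diff x y ∩ S, bitSign (y i) * bitSign (r i)
      = -∑ i ∈ Cube.diff x y ∩ S, bitSign (x i) * bitSign (r i) := by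
  rw [← Finset.sum_neg_distrib]
  refine Finset.sum_congr rfl fun i hi => ?_
  have h : y i = !x i := by
    simp only [Cube.diff, Finset.mem_inter, Finset.mem_filter, Finset.mem_univ, true_and] at hi
    revert hi
    cases x i <;> cases y i <;> simp
  rw [h, bitSign_not, neg_mul]

theorem weight_mix (r x y : Cube n) :
    ((Cube.mix r x y).weight : ℝ)
      = ((x.weight : ℝ) + y.weight) / 2 + 1 / 2 * ∑ i ∈ Cube.diff x y, bitSign (r i) := by
  have h : ∀ i, 1 / 2 * bitSign (Cube.mix r x y i)
      = (1 / 2 * bitSign (x i) + 1 / 2 * bitSign (y i)) / 2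
        + 1 / 2 * (if i ∈ Cube.diff x y then bitSign (r i) else 0) := fun i => by
    by_cases hi : x i = y i
    · simp [Cube.mix, Cube.diff, hi]
    · have h' : y i = !x i := by
        revert hi
        cases x i <;> cases y i <;> simp
      simp [Cube.mix, Cube.diff, h', bitSign_not]
  have h' : ∑ i, 1 / 2 * (if i ∈ Cube.diff x y then bitSign (r i) else 0)
      = 1 / 2 * ∑ i ∈ Cube.diff x y, bitSign (r i) := by
    rw [← Finset.mul_sum, Finset.sum_ite_mem, Finset.univ_inter]
  rw [weight_eq_sum, weight_eq_sum x, weight_eq_sum y, Finset.sum_congr rfl fun i _ => h i,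
    Finset.sum_add_distrib, ← Finset.sum_div, Finset.sum_add_distrib, h']
  ring

/-- The invariant of the bisection loop: `x` has value `0` and `y` has value `1`, they differ in
at least `a` coordinates of `N` and in at most `b` coordinates altogether, and their weights are
within `g` of the middle. -/
structure BisectState (h : Cube n → Bool) (N : Finset (Fin n)) (a b g : ℝ) (x y : Cube n) :
    Prop where
  left : h x = false
  right : h y = true
  le_card : a ≤ (Cube.diff x y ∩ N).card
  card_le : ((Cube.diff x y).card : ℝ) ≤ b
  weight_left : |(x.weight : ℝ) - n / 2| ≤ g
  weight_right : |(y.weight : ℝ) - n / 2| ≤ g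

theorem BisectState.mono {h : Cube n → Bool} {N : Finset (Fin n)} {a b g a' b' g' : ℝ}
    {x y : Cube n} (hs : BisectState h N a b g x y) (ha : a' ≤ a) (hb : b ≤ b') (hg : g ≤ g') :
    BisectState h N a' b' g' x y :=
  ⟨hs.left, hs.right, ha.trans hs.le_card, hs.card_le.trans hb, hs.weight_left.trans hg,
    hs.weight_right.trans hg⟩

/-- The seed `r` splits `Cube.diff x y`, or its part in `N`, into two parts of which one has
size at least `t` more than a half. -/
def UnevenSplit (x y : Cube n) (N : Finset (Fin n)) (t : ℝ) (r : Cube n) : Prop :=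
  2 * t ≤ |∑ i ∈ Cube.diff x y, bitSign (x i) * bitSign (r i)| ∨
    2 * t ≤ |∑ i ∈ Cube.diff x y ∩ N, bitSign (x i) * bitSign (r i)|

theorem prob_unevenSplit_le {x y : Cube n} {N : Finset (Fin n)} {b t : ℝ} (ht : 0 < t)
    (hb : ((Cube.diff x y).card : ℝ) ≤ b) : prob (UnevenSplit x y N t) ≤ b / (2 * t ^ 2) := by
  have h2 : ((Cube.diff x y ∩ N).card : ℝ) ≤ b :=
    le_trans (by exact_mod_cast Finset.card_le_card Finset.inter_subset_left) hb
  have h := fun S => prob_le_abs_sum_bitSign S (fun i => bitSign (x i))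
    (fun i => abs_bitSign _) (by positivity : 0 < 2 * t)
  refine (prob_or_le _ _).trans ((add_le_add (h _) (h _)).trans ?_)
  rw [← add_div, div_le_div_iff₀ (by positivity) (by positivity)]
  nlinarith [sq_nonneg t]

/-- Whichever half the bisection keeps, an even split preserves the invariant: both halves
deviate from one half by the same amount. -/
theorem BisectState.step {h : Cube n → Bool} {N : Finset (Fin n)} {a b g g' t : ℝ}
    {x y r : Cube n} (hs : BisectState h N a b g x y) (hr : ¬ UnevenSplit x y N t r)
    (hg : g ≤ g') (hw : |((Cube.mix r x y).weight : ℝ) - n / 2| ≤ g') :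
    (h (Cube.mix r x y) = false → BisectState h N (a / 2 - t) (b / 2 + t) g' (Cube.mix r x y) y) ∧
    (h (Cube.mix r x y) = true → BisectState h N (a / 2 - t) (b / 2 + t) g' x (Cube.mix r x y)) := by
  simp only [UnevenSplit, not_or, not_le, abs_lt] at hr
  obtain ⟨⟨h1, h2⟩, h3, h4⟩ := hr
  have hu := Finset.inter_univ (Cube.diff x y)
  have e1 := congrArg (fun S => (S.card : ℝ)) (diff_mix_inter r x y N)
  have e2 := congrArg (fun S => (S.card : ℝ)) (mix_diff_inter r x y N)
  have e3 := congrArg (fun S => (S.card : ℝ)) (diff_mix_inter r x y Finset.univ)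
  have e4 := congrArg (fun S => (S.card : ℝ)) (mix_diff_inter r x y Finset.univ)
  simp only [card_filter_ne_eq, sum_diff_inter_neg] at e1 e2 e3 e4
  rw [hu, Finset.inter_univ] at e3 e4
  have hl := hs.le_card
  have hc := hs.card_le
  constructor <;> intro hz
  · exact ⟨hz, hs.right, by linarith, by linarith, hw, hs.weight_right.trans hg⟩
  · exact ⟨hs.left, hz, by linarith, by linarith, hs.weight_left.trans hg, hw⟩

/-! ### The bisection loop -/

open Classical in
/-- The probability, over the `k` seeds, that the bisection loop between `x` and `y` followed by
the inspection of the remaining subcube fails to reject with all queries in `M`. -/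
noncomputable def bisectFail (M : Set (Cube n)) (h : Cube n → Bool) (s k : ℕ) (x y : Cube n) :
    ℝ :=
  expectList (Cube n) k fun rs =>
    if ((DTree.bisect s rs x y).restrict M).run h = false then 0 else 1

theorem bisectFail_le_one (M : Set (Cube n)) (h : Cube n → Bool) (s k : ℕ) (x y : Cube n) :
    bisectFail M h s k x y ≤ 1 := by
  refine (expectList_mono fun l => ?_).trans (expectList_const (α := Cube n) k 1).le
  split_ifs <;> norm_num

open Classical in
theorem bisectFail_succ (M : Set (Cube n)) (h : Cube n → Bool) (s k : ℕ) (x y : Cube n) :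
    bisectFail M h s (k + 1) x y = 𝔼 r : Cube n,
      if Cube.mix r x y ∈ M then
        if h (Cube.mix r x y) = true then bisectFail M h s k x (Cube.mix r x y)
        else bisectFail M h s k (Cube.mix r x y) y
      else 1 := by
  rw [bisectFail, expectList]
  refine Finset.expect_congr rfl fun r _ => ?_
  split_ifs with h1 h2
  · simp only [DTree.bisect, DTree.run_restrict_query h1, h2, if_true]
    rfl
  · simp only [DTree.bisect, DTree.run_restrict_query h1, h2]
    rfl
  · simp only [DTree.bisect, DTree.restrict, h1, if_false, DTree.run]
    exact expectList_const k 1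

/-- The failure probability of one more step is bounded by the probability of a bad seed plus
the failure probability from the states that the good seeds lead to. -/
theorem bisectFail_succ_le {M : Set (Cube n)} {h : Cube n → Bool} {s k : ℕ} {x y : Cube n}
    {q : ℝ} (good : Cube n → Prop) (hM : ∀ r, good r → Cube.mix r x y ∈ M)
    (hleft : ∀ r, good r → h (Cube.mix r x y) = false →
      bisectFail M h s k (Cube.mix r x y) y ≤ q)
    (hright : ∀ r, good r → h (Cube.mix r x y) = true →
      bisectFail M h s k x (Cube.mix r x y) ≤ q) :
    bisectFail M h s (k + 1) x y ≤ 1 - (1 - q) * prob good := by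
  classical
  rw [bisectFail_succ]
  calc _ ≤ 𝔼 r : Cube n, (1 - (1 - q) * if good r then 1 else 0) := by
        refine Finset.expect_le_expect fun r _ => ?_
        by_cases hr : good r
        · rw [if_pos (hM r hr), if_pos hr, mul_one, sub_sub_cancel]
          split_ifs with hz
          · exact hright r hr hz
          · exact hleft r hr (by simpa using hz)
        · rw [if_neg hr, mul_zero, sub_zero]
          split_ifs
          exacts [bisectFail_le_one _ _ _ _ _ _, bisectFail_le_one _ _ _ _ _ _, le_rfl]
    _ = 1 - (1 - q) * prob good := by
        rw [Finset.expect_sub_distrib, Finset.expect_const Finset.univ_nonempty,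
          ← Finset.mul_expect, prob]

theorem abs_weight_sub_le_of_mem_hybrid {x y z : Cube n} (hz : z ∈ Cube.hybrid x y) :
    |(z.weight : ℝ) - x.weight| ≤ (Cube.diff x y).card := by
  rw [weight_eq_sum, weight_eq_sum x, add_sub_add_left_eq_sub, ← Finset.sum_sub_distrib]
  refine (Finset.abs_sum_le_sum_abs _ _).trans ?_
  rw [Cube.diff, Finset.card_filter]
  push_cast
  refine Finset.sum_le_sum fun i _ => ?_
  simp only [Cube.hybrid, Finset.mem_filter, Finset.mem_univ, true_and] at hz
  by_cases hi : x i = y i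
  · simp [hi, hz i hi]
  · rw [if_pos hi, ← mul_sub]
    cases z i <;> cases x i <;> norm_num [bitSign]

/-- The inspection of the final subcube succeeds if enough negative weights have survived. -/
theorem BisectState.bisectFail_zero {h f : Cube n → Bool} {w : Fin n → ℝ} {θ ν K g δ : ℝ}
    {s : ℕ} {N : Finset (Fin n)} {x y : Cube n} (hf : IsLTFWith f w θ)
    (hagree : ∀ z ∈ middleLayers n δ, h z = f z) (hν : 0 ≤ ν) (hN : ∀ i ∈ N, w i ≤ -ν)
    (hw : ∀ j, w j ≤ K * ν) (hg : g + s ≤ δ * Real.sqrt n) (hs : BisectState h N K s g x y) :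
    bisectFail (middleLayers n δ) h s 0 x y ≤ 0 := by
  have hM : ∀ z ∈ Cube.hybrid x y, z ∈ middleLayers n δ := fun z hz => by
    rw [mem_middleLayers_iff]
    have h1 := abs_weight_sub_le_of_mem_hybrid hz
    have h2 := abs_sub_le (z.weight : ℝ) x.weight (n / 2)
    linarith [hs.card_le, hs.weight_left]
  have hx : x ∈ Cube.hybrid x y := by simp [Cube.hybrid]
  have hy : y ∈ Cube.hybrid x y := by simp [Cube.hybrid, eq_comm]
  obtain ⟨u, hu, v, hv, huv, hc, hfu, hfv⟩ := hf.exists_decreasing_edge (x := x) (y := y)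
    (by rw [← hagree x (hM x hx), hs.left]) (by rw [← hagree y (hM y hy), hs.right])
    (E := Cube.diff x y ∩ N) Finset.inter_subset_left
    (fun i hi => (hN i (Finset.mem_inter.1 hi).2).trans (by linarith))
    (fun j => (hw j).trans <| by
      calc K * ν ≤ (Cube.diff x y ∩ N).card * ν := by gcongr; exact hs.le_card
        _ = ∑ i ∈ Cube.diff x y ∩ N, ν := by rw [Finset.sum_const, nsmul_eq_mul]
        _ ≤ _ := Finset.sum_le_sum fun i hi => by linarith [hN i (Finset.mem_inter.1 hi).2])
  have := DTree.run_restrict_finish (f := h) (by exact_mod_cast hs.card_le) hM hu hv huv hc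
    (by rw [hagree u (hM u hu), hfu]) (by rw [hagree v (hM v hv), hfv])
  simp [bisectFail, expectList, DTree.bisect, this]

/-- The induction behind `BisectState.bisectFail_le`, with `j` steps to go and `i` steps done.
In the step with `j` more steps to follow, the sizes may deviate by `L * (3 / 2) ^ j`, and the
weight by `P * (3 / 4) ^ (i + 1)`. The first kind of deviation is large relative to the standard
deviation when many steps follow, the second kind when many steps have been done, so that both
the failure probabilities and the relative deviations sum to geometric series. -/
theorem bisectFail_le_geometric {M : Set (Cube n)} {h : Cube n → Bool} {N : Finset (Fin n)}
    {s : ℕ} {δ K L P Q g : ℝ} (hM : M = middleLayers n δ) (hL : 0 < L) (hP : 0 < P) (hQ : 0 < Q)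
    (hg : g + 3 * P ≤ δ * Real.sqrt n)
    (hfin : ∀ x y, BisectState h N K s (g + 3 * P) x y → bisectFail M h s 0 x y ≤ 0)
    (j i : ℕ) (hPQ : P ^ 2 = Q * 2 ^ (i + j)) (x y : Cube n)
    (hs : BisectState h N (2 ^ j * (K + 4 * L * (1 - (3 / 4) ^ j)))
      (2 ^ j * (s - 4 * L * (1 - (3 / 4) ^ j))) (g + 3 * P * (1 - (3 / 4) ^ i)) x y) :
    bisectFail M h s j x y ≤ 9 * s / L ^ 2 * (1 - (8 / 9) ^ j)
      + 4 * s / Q * ((8 / 9) ^ i - (8 / 9) ^ (i + j)) := by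
  induction j generalizing i x y with
  | zero =>
    simp only [pow_zero, sub_self, mul_zero, add_zero, one_mul, sub_zero] at hs ⊢
    refine hfin x y (hs.mono le_rfl le_rfl ?_)
    have : 0 ≤ P * (3 / 4 : ℝ) ^ i := by positivity
    linarith
  | succ j ih =>
    set t := L * (3 / 2) ^ j with ht
    set t' := P * (3 / 4) ^ (i + 1) with ht'
    have ht0 : 0 < t := by positivity
    have ht0' : 0 < t' := by positivity
    set b := (2 : ℝ) ^ (j + 1) * (s - 4 * L * (1 - (3 / 4) ^ (j + 1))) with hb
    have hbs : b ≤ 2 ^ (j + 1) * s := by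
      have : (3 / 4 : ℝ) ^ (j + 1) ≤ 1 := pow_le_one₀ (by norm_num) (by norm_num)
      rw [hb]
      gcongr
      nlinarith
    set q := 9 * s / L ^ 2 * (1 - (8 / 9) ^ j)
      + 4 * s / Q * ((8 / 9) ^ (i + 1) - (8 / 9) ^ (i + 1 + j)) with hq
    have h32 : (2 : ℝ) ^ j * (3 / 4) ^ j = (3 / 2) ^ j := by rw [← mul_pow]; norm_num
    have hwt : g + 3 * P * (1 - (3 / 4) ^ i) + t' = g + 3 * P * (1 - (3 / 4) ^ (i + 1)) := by
      rw [ht']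
      ring
    have hgM : g + 3 * P * (1 - (3 / 4) ^ (i + 1)) ≤ δ * Real.sqrt n := by
      have : 0 ≤ P * (3 / 4 : ℝ) ^ (i + 1) := by positivity
      linarith
    let bad : Cube n → Prop := fun r =>
      UnevenSplit x y N t r ∨ 2 * t' ≤ |∑ i ∈ Cube.diff x y, 1 * bitSign (r i)|
    have hbad : prob bad ≤ s / L ^ 2 * (8 / 9) ^ j + s / (2 * Q) * (8 / 9) ^ (i + 1) := by
      refine (prob_or_le _ _).trans (add_le_add ?_ ?_)
      · refine (prob_unevenSplit_le ht0 (hs.card_le.trans hbs)).trans (le_of_eq ?_)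
        have e : (8 / 9 : ℝ) ^ j = 2 ^ j / ((3 / 2) ^ j) ^ 2 := by
          rw [← pow_mul, mul_comm j 2, pow_mul, ← div_pow]
          norm_num
        have hX : 0 < (3 / 2 : ℝ) ^ j := by positivity
        rw [ht, e]
        generalize (3 / 2 : ℝ) ^ j = X at hX
        field_simp
        ring
      · refine (prob_le_abs_sum_bitSign _ (fun _ => 1) (by simp)
          (by positivity : 0 < 2 * t')).trans ?_
        calc ((Cube.diff x y).card : ℝ) / (2 * t') ^ 2 ≤ 2 ^ (j + 1) * s / (2 * t') ^ 2 := by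
              gcongr
              exact hs.card_le.trans hbs
          _ = 2 ^ (j + 1) * s / (4 * P ^ 2 * ((3 / 4) ^ (i + 1)) ^ 2) := by
              rw [ht']
              ring
          _ = _ := by
              have e : (8 / 9 : ℝ) ^ (i + 1) = 1 / (2 ^ (i + 1) * ((3 / 4) ^ (i + 1)) ^ 2) := by
                rw [← pow_mul, mul_comm (i + 1) 2, pow_mul, ← mul_pow, ← one_div_pow]
                norm_num
              have hX : 0 < (3 / 4 : ℝ) ^ (i + 1) := by positivity
              rw [e, hPQ]
              generalize (3 / 4 : ℝ) ^ (i + 1) = X at hX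
              rw [show i + (j + 1) = i + 1 + j by ring, pow_add _ (i + 1) j, pow_succ _ j]
              field_simp
              ring
    have hmix : ∀ r, ¬ bad r →
        |((Cube.mix r x y).weight : ℝ) - n / 2| ≤ g + 3 * P * (1 - (3 / 4) ^ (i + 1)) :=
        fun r hr => by
      simp only [bad, not_or, not_le, one_mul] at hr
      have h1 := abs_lt.1 hr.2
      have h2 := abs_le.1 hs.weight_left
      have h3 := abs_le.1 hs.weight_right
      rw [weight_mix, abs_le]
      constructor <;> linarith
    have hstep := fun r (hr : ¬ bad r) => hs.step (fun h' => hr (Or.inl h'))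
      (by linarith : g + 3 * P * (1 - (3 / 4) ^ i) ≤ g + 3 * P * (1 - (3 / 4) ^ (i + 1)))
      (hmix r hr)
    have halpha : (2 : ℝ) ^ j * (K + 4 * L * (1 - (3 / 4) ^ j))
        = 2 ^ (j + 1) * (K + 4 * L * (1 - (3 / 4) ^ (j + 1))) / 2 - t := by
      rw [ht, ← h32]
      ring
    have hbeta : b / 2 + t = (2 : ℝ) ^ j * (s - 4 * L * (1 - (3 / 4) ^ j)) := by
      rw [ht, hb, ← h32]
      ring
    have hstep' := fun r (hr : ¬ bad r) =>
      And.intro (fun h0 => ((hstep r hr).1 h0).mono (a' := 2 ^ j * (K + 4 * L * (1 - (3 / 4) ^ j)))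
        (b' := 2 ^ j * (s - 4 * L * (1 - (3 / 4) ^ j)))
          halpha.le hbeta.le
          le_rfl)
        (fun h1 => ((hstep r hr).2 h1).mono (a' := 2 ^ j * (K + 4 * L * (1 - (3 / 4) ^ j)))
        (b' := 2 ^ j * (s - 4 * L * (1 - (3 / 4) ^ j)))
          halpha.le hbeta.le
          le_rfl)
    have hij : i + 1 + j = i + (j + 1) := by ring
    have hrec := fun x y => ih (i + 1) (by rw [hPQ, hij]) x y
    have hmain := bisectFail_succ_le (M := M) (h := h) (s := s) (k := j) (x := x) (y := y)
      (q := q) (fun r => ¬ bad r)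
      (fun r hr => by rw [hM, mem_middleLayers_iff]; exact (hmix r hr).trans hgM)
      (fun r hr h0 => hrec _ _ ((hstep' r hr).1 h0))
      (fun r hr h1 => hrec _ _ ((hstep' r hr).2 h1))
    have hnot := prob_add_prob_not bad
    have hq0 : 0 ≤ q := by
      have e1 : (8 / 9 : ℝ) ^ j ≤ 1 := pow_le_one₀ (by norm_num) (by norm_num)
      have e2 : (8 / 9 : ℝ) ^ (i + 1 + j) ≤ (8 / 9) ^ (i + 1) :=
        pow_le_pow_of_le_one (by norm_num) (by norm_num) (by omega)
      have e3 : 0 ≤ 1 - (8 / 9 : ℝ) ^ j := by linarith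
      have e4 : 0 ≤ (8 / 9 : ℝ) ^ (i + 1) - (8 / 9) ^ (i + 1 + j) := by linarith
      positivity
    have hb0 := prob_nonneg bad
    have hle : 1 - (1 - q) * prob (fun r => ¬ bad r) ≤ q + prob bad := by
      rw [← eq_sub_iff_add_eq'] at hnot
      rw [hnot]
      nlinarith
    refine hmain.trans (hle.trans ((add_le_add_right hbad q).trans (le_of_eq ?_)))
    rw [hq, ← hij]
    ring

/-- The bisection succeeds with probability at least `9 / 10` from any state in which `x` and
`y` have sufficient distance, not too much of it, and weights far enough from the boundary of
the middle layers. -/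
theorem BisectState.bisectFail_le {h f : Cube n → Bool} {w : Fin n → ℝ} {θ ν K a b g δ : ℝ}
    {s k : ℕ} {N : Finset (Fin n)} {x y : Cube n} (hf : IsLTFWith f w θ)
    (hagree : ∀ z ∈ middleLayers n δ, h z = f z) (hν : 0 ≤ ν) (hN : ∀ i ∈ N, w i ≤ -ν)
    (hw : ∀ j, w j ≤ K * ν) (hs1 : 12800 ≤ s)
    (ha : 2 ^ k * (K + 60 * Real.sqrt s) ≤ a) (hb : b ≤ 2 ^ k * (s / 2))
    (hg : g + 30 * Real.sqrt (s * 2 ^ k) + s ≤ δ * Real.sqrt n)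
    (hs : BisectState h N a b g x y) :
    bisectFail (middleLayers n δ) h s k x y ≤ 1 / 10 := by
  have hs0 : (12800 : ℝ) ≤ s := by exact_mod_cast hs1
  have hs0' : (0 : ℝ) < s := by linarith
  set L := Real.sqrt (200 * s) with hL
  have hL2 : L ^ 2 = 200 * s := Real.sq_sqrt (by positivity)
  have hL0 : 0 < L := Real.sqrt_pos.2 (by positivity)
  set P := 10 * Real.sqrt (s * 2 ^ k) with hP
  have hP2 : P ^ 2 = 100 * s * 2 ^ (0 + k) := by
    rw [hP, mul_pow, Real.sq_sqrt (by positivity), zero_add]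
    ring
  have hP0 : 0 < P := by positivity
  have h34 : (3 / 4 : ℝ) ^ k ≤ 1 := pow_le_one₀ (by norm_num) (by norm_num)
  have h34' : 0 < (3 / 4 : ℝ) ^ k := by positivity
  have hL15 : L ≤ 15 * Real.sqrt s := by
    refine Real.sqrt_le_iff.2 ⟨by positivity, ?_⟩
    rw [mul_pow, Real.sq_sqrt hs0'.le]
    linarith
  have hL8 : L ≤ s / 8 := Real.sqrt_le_iff.2 ⟨by positivity, by nlinarith⟩
  have hmain := bisectFail_le_geometric (M := middleLayers n δ) (h := h) (N := N) (s := s)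
    (K := K) (L := L) (P := P) (Q := 100 * s) (g := g) rfl hL0 hP0 (by positivity)
    (by rw [hP]; linarith)
    (fun x y hxy => hxy.bisectFail_zero hf hagree hν hN hw (by rw [hP]; linarith)) k 0 hP2 x y
    (hs.mono (ha.trans' ?_) (hb.trans ?_) (by simp))
  · refine hmain.trans ?_
    rw [hL2, show 9 * (s : ℝ) / (200 * s) = 9 / 200 by field_simp,
      show 4 * (s : ℝ) / (100 * s) = 4 / 100 by field_simp]
    have : 0 < (8 / 9 : ℝ) ^ k := by positivity
    have : 0 < (8 / 9 : ℝ) ^ (0 + k) := by positivity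
    rw [pow_zero]
    linarith
  · exact mul_le_mul_of_nonneg_left (by nlinarith) (by positivity)
  · exact mul_le_mul_of_nonneg_left (by nlinarith) (by positivity)

/-! ### Bisection inside thin middle layers -/

/-- A random point between two points of the middle layers stays there with probability
bounded below: it does so if its weight deviates from the mean in the right direction
and by little. -/
theorem le_prob_mix_mem {p μ g : ℝ} (hp : ∀ D : Finset (Fin n),
      p ≤ prob fun r : Cube n => 0 ≤ 1 / 2 * ∑ i ∈ D, bitSign (r i) ∧
        1 / 2 * ∑ i ∈ D, bitSign (r i) ≤ μ * Real.sqrt n)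
    (hg : μ * Real.sqrt n ≤ g) {x y : Cube n} (hx : |(x.weight : ℝ) - n / 2| ≤ g)
    (hy : |(y.weight : ℝ) - n / 2| ≤ g) :
    p ≤ prob fun r => |((Cube.mix r x y).weight : ℝ) - n / 2| ≤ g := by
  rw [abs_le] at hx hy
  have h := hp (Cube.diff x y)
  rcases le_total (((x.weight : ℝ) + y.weight) / 2) (n / 2) with hm | hm
  · refine h.trans (prob_mono fun r hr => ?_)
    rw [weight_mix, abs_le]
    constructor <;> linarith [hr.1, hr.2]
  · rw [← prob_sum_bitSign_neg (Cube.diff x y)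
      fun t => 0 ≤ 1 / 2 * t ∧ 1 / 2 * t ≤ μ * Real.sqrt n] at h
    refine h.trans (prob_mono fun r hr => ?_)
    rw [weight_mix, abs_le]
    constructor <;> linarith [hr.1, hr.2]

/-- With `T` additional steps at the beginning, each of which stays within distance `g` of the
middle weight with probability at least `p` and does not split the points too unevenly, the
success probability decreases by a constant factor at most. -/
theorem BisectState.bisectFail_add_le {h : Cube n → Bool} {N : Finset (Fin n)} {s k T : ℕ}
    {a b g δ p q : ℝ} (hgδ : g ≤ δ * Real.sqrt n)
    (hmix : ∀ x y : Cube n, |(x.weight : ℝ) - n / 2| ≤ g → |(y.weight : ℝ) - n / 2| ≤ g →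
      p ≤ prob fun r => |((Cube.mix r x y).weight : ℝ) - n / 2| ≤ g)
    (hp : 0 ≤ p) (hq : 0 ≤ q)
    (hend : ∀ x y, BisectState h N (a / 4 ^ T) (b * (3 / 4) ^ T) g x y →
      bisectFail (middleLayers n δ) h s k x y ≤ 1 - q)
    (ha : 0 < a) (hab : a ≤ b) (hbad : 8 * b * 16 ^ T / a ^ 2 ≤ p / 2) {x y : Cube n}
    (hs : BisectState h N a b g x y) :
    bisectFail (middleLayers n δ) h s (k + T) x y ≤ 1 - (p / 2) ^ T * q := by
  induction T generalizing a b x y with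
  | zero => simpa using hend x y (by simpa using hs)
  | succ T ih =>
    have hrec : ∀ x y, BisectState h N (a / 2 - a / 4) (b / 2 + a / 4) g x y →
        bisectFail (middleLayers n δ) h s (k + T) x y ≤ 1 - (p / 2) ^ T * q := fun x y hxy => by
      refine ih (a := a / 4) (b := b * (3 / 4)) (fun x y hxy => hend x y ?_) (by positivity)
        (by linarith) (le_trans (le_of_eq_of_le ?_ (?_ :
          8 * b * 16 ^ (T + 1) / a ^ 2 * (3 / 4) ≤ 8 * b * 16 ^ (T + 1) / a ^ 2)) hbad)
        (hxy.mono (by linarith) (by linarith) le_rfl)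
      · refine hxy.mono (le_of_eq ?_) (le_of_eq ?_) le_rfl
        · rw [div_div, pow_succ']
        · rw [mul_assoc, pow_succ']
      · field_simp
        ring
      · have : 0 ≤ 8 * b * 16 ^ (T + 1) / a ^ 2 := by
          have := ha.le.trans hab
          positivity
        linarith
    let good : Cube n → Prop := fun r =>
      |((Cube.mix r x y).weight : ℝ) - n / 2| ≤ g ∧ ¬ UnevenSplit x y N (a / 4) r
    have hgood : p / 2 ≤ prob good := by
      have h1 := hmix x y hs.weight_left hs.weight_right
      have h2 : prob (fun r => |((Cube.mix r x y).weight : ℝ) - n / 2| ≤ g)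
          ≤ prob good + prob (UnevenSplit x y N (a / 4)) := by
        refine (prob_mono fun r hr => ?_).trans (prob_or_le _ _)
        by_cases hu : UnevenSplit x y N (a / 4) r
        · exact Or.inr hu
        · exact Or.inl ⟨hr, hu⟩
      have h3 := prob_unevenSplit_le (N := N) (by positivity : 0 < a / 4) hs.card_le
      have h4 : b / (2 * (a / 4) ^ 2) ≤ 8 * b * 16 ^ (T + 1) / a ^ 2 := by
        have hb := ha.le.trans hab
        rw [show b / (2 * (a / 4) ^ 2) = 8 * b * 1 / a ^ 2 by field_simp; ring]
        gcongr
        exact one_le_pow₀ (by norm_num)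
      linarith
    have hstep := fun r (hr : good r) => hs.step hr.2 le_rfl hr.1
    have hmain := bisectFail_succ_le (M := middleLayers n δ) (h := h) (s := s) (k := k + T)
      (x := x) (y := y) (q := 1 - (p / 2) ^ T * q) good
      (fun r hr => mem_middleLayers_iff.2 (hr.1.trans hgδ))
      (fun r hr h0 => hrec _ _ ((hstep r hr).1 h0))
      (fun r hr h1 => hrec _ _ ((hstep r hr).2 h1))
    rw [sub_sub_cancel] at hmain
    refine hmain.trans (sub_le_sub_left ?_ 1)
    calc (p / 2) ^ (T + 1) * q = (p / 2) ^ T * q * (p / 2) := by ring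
      _ ≤ (p / 2) ^ T * q * prob good := by gcongr

/-! ### The search for the endpoints -/

open Classical in
/-- The probability, over `m` candidates and `k` seeds, that the search for a point with a value
other than `b`, followed by the bisection between that point and `x`, fails to reject with all
queries in `M`. -/
noncomputable def searchFail (M : Set (Cube n)) (h : Cube n → Bool) (s m k : ℕ) (x : Cube n)
    (b : Bool) : ℝ :=
  expectList (Cube n) m fun ys => expectList (Cube n) k fun rs =>
    if ((DTree.search s rs x b ys).restrict M).run h = false then 0 else 1

/-- The failure probability of the bisection between `x` and `y`, where `b` is the value of `x`
and `y` has the other value. -/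
noncomputable def pairFail (M : Set (Cube n)) (h : Cube n → Bool) (s k : ℕ) (x y : Cube n)
    (b : Bool) : ℝ :=
  if b = true then bisectFail M h s k y x else bisectFail M h s k x y

theorem pairFail_le_one (M : Set (Cube n)) (h : Cube n → Bool) (s k : ℕ) (x y : Cube n)
    (b : Bool) : pairFail M h s k x y b ≤ 1 := by
  rw [pairFail]
  split_ifs <;> exact bisectFail_le_one _ _ _ _ _ _

theorem searchFail_le_one (M : Set (Cube n)) (h : Cube n → Bool) (s m k : ℕ) (x : Cube n)
    (b : Bool) : searchFail M h s m k x b ≤ 1 := by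
  refine (expectList_mono fun l => ?_).trans (expectList_const (α := Cube n) m 1).le
  refine (expectList_mono fun l => ?_).trans (expectList_const (α := Cube n) k 1).le
  split_ifs <;> norm_num

open Classical in
theorem searchFail_succ (M : Set (Cube n)) (h : Cube n → Bool) (s m k : ℕ) (x : Cube n)
    (b : Bool) : searchFail M h s (m + 1) k x b = 𝔼 y : Cube n,
      if y ∈ M then if h y = b then searchFail M h s m k x b else pairFail M h s k x y b
      else 1 := by
  rw [searchFail, expectList]
  refine Finset.expect_congr rfl fun y _ => ?_
  by_cases hy : y ∈ M
  · rw [if_pos hy]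
    cases b <;> cases hhy : h y <;>
      simp [DTree.search, DTree.run_restrict_query hy, hhy, searchFail, pairFail, bisectFail,
        expectList_const]
  · rw [if_neg hy]
    cases b <;> simp [DTree.search, DTree.restrict, hy, DTree.run, expectList_const]

/-- If all but few of the pairs with different values lead to success with high probability,
then so does the search, up to the probability `q ^ m` of finding no pair. -/
theorem searchFail_le {M : Set (Cube n)} {h : Cube n → Bool} {s k : ℕ} {x : Cube n}
    {b : Bool} {q π ρ : ℝ} (good : Cube n → Prop) (hM : ∀ y, good y → y ∈ M)
    (hρ : ∀ y, good y → h y ≠ b → pairFail M h s k x y b ≤ ρ) (hρ0 : 0 ≤ ρ) (hq0 : 0 ≤ q) (hq1 : q ≤ 1)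
    (hq : prob (fun y => h y = b) ≤ q) (hπ : prob (fun y => ¬ good y) ≤ π) (m : ℕ) :
    searchFail M h s m k x b ≤ q ^ m + m * π + ρ := by
  classical
  have hπ0 : 0 ≤ π := (prob_nonneg _).trans hπ
  induction m with
  | zero =>
    refine (searchFail_le_one _ _ _ _ _ _ _).trans ?_
    simpa using hρ0
  | succ m ih =>
    rw [searchFail_succ]
    calc _ ≤ 𝔼 y : Cube n, ((if ¬ good y then 1 else 0)
          + (q ^ m + m * π) * (if h y = b then 1 else 0) + ρ) := by
          refine Finset.expect_le_expect fun y _ => ?_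
          have h0 : 0 ≤ (q ^ m + m * π) * (if h y = b then (1 : ℝ) else 0) := by
            split_ifs <;> positivity
          by_cases hy : good y
          · rw [if_pos (hM y hy), if_neg (not_not.2 hy)]
            by_cases hb : h y = b
            · rw [if_pos hb, if_pos hb]
              linarith
            · rw [if_neg hb]
              linarith [hρ y hy hb]
          · rw [if_pos hy]
            have : (if y ∈ M then if h y = b then searchFail M h s m k x b
                else pairFail M h s k x y b else 1) ≤ 1 := by
              split_ifs
              exacts [searchFail_le_one _ _ _ _ _ _ _, pairFail_le_one _ _ _ _ _ _ _, le_rfl]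
            linarith
      _ = prob (fun y => ¬ good y) + (q ^ m + m * π) * prob (fun y => h y = b) + ρ := by
          rw [Finset.expect_add_distrib, Finset.expect_add_distrib, ← Finset.mul_expect,
            Finset.expect_const Finset.univ_nonempty, prob, prob]
          congr!
      _ ≤ π + (q ^ m + m * π) * q + ρ := by gcongr
      _ ≤ _ := by
          have : m * π * q ≤ m * π * 1 := by gcongr
          push_cast
          rw [pow_succ]
          linarith

/-- The contribution of the first candidate to the success probability of the search. -/
theorem searchFail_succ_le {M : Set (Cube n)} {h : Cube n → Bool} {s m k : ℕ} {x : Cube n}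
    {b : Bool} {q : ℝ} (good : Cube n → Prop) (hM : ∀ y, good y → y ∈ M)
    (hb : ∀ y, good y → h y ≠ b) (hq : ∀ y, good y → pairFail M h s k x y b ≤ 1 - q) :
    searchFail M h s (m + 1) k x b ≤ 1 - q * prob good := by
  classical
  rw [searchFail_succ]
  calc _ ≤ 𝔼 y : Cube n, (1 - q * if good y then 1 else 0) := by
        refine Finset.expect_le_expect fun y _ => ?_
        by_cases hy : good y
        · rw [if_pos (hM y hy), if_neg (hb y hy), if_pos hy, mul_one]
          exact hq y hy
        · rw [if_neg hy, mul_zero, sub_zero]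
          split_ifs
          exacts [searchFail_le_one _ _ _ _ _ _ _, pairFail_le_one _ _ _ _ _ _ _, le_rfl]
    _ = 1 - q * prob good := by
        rw [Finset.expect_sub_distrib, Finset.expect_const Finset.univ_nonempty,
          ← Finset.mul_expect, prob]

open Classical in
/-- The probability that the bisection algorithm rejects with all queries in `M`. -/
theorem prob_run_bisection_restrict (M : Set (Cube n)) (h : Cube n → Bool) (s m k : ℕ) :
    prob (fun c : Cube n × (Fin m → Cube n) × (Fin k → Cube n) =>
      ((DTree.bisection s c.1 (List.ofFn c.2.1) (List.ofFn c.2.2)).restrict M).run h = false)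
    = 1 - 𝔼 x : Cube n, if x ∈ M then searchFail M h s m k x (h x) else 1 := by
  set F : Cube n → List (Cube n) → List (Cube n) → ℝ := fun x ys rs =>
    if ((DTree.bisection s x ys rs).restrict M).run h = false then 0 else 1 with hF
  have h1 := prob_add_prob_not (fun c : Cube n × (Fin m → Cube n) × (Fin k → Cube n) =>
    ((DTree.bisection s c.1 (List.ofFn c.2.1) (List.ofFn c.2.2)).restrict M).run h = false)
  have h2 : prob (fun c : Cube n × (Fin m → Cube n) × (Fin k → Cube n) =>
      ¬ ((DTree.bisection s c.1 (List.ofFn c.2.1) (List.ofFn c.2.2)).restrict M).run h = false)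
      = 𝔼 x, expectList (Cube n) m fun ys => expectList (Cube n) k fun rs => F x ys rs := by
    calc _ = 𝔼 c : Cube n × (Fin m → Cube n) × (Fin k → Cube n),
          F c.1 (List.ofFn c.2.1) (List.ofFn c.2.2) := by
          refine Finset.expect_congr rfl fun c _ => ?_
          simp only [hF]
          split_ifs <;> simp_all
      _ = _ := by
          rw [expect_prod_type]
          refine Finset.expect_congr rfl fun x _ => ?_
          rw [expect_prod_type, ← expect_ofFn]
          exact Finset.expect_congr rfl fun ys _ => expect_ofFn k fun rs => F x (List.ofFn ys) rs
  rw [h2] at h1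
  rw [eq_sub_iff_add_eq]
  refine Eq.trans (congrArg _ ?_) h1
  refine Finset.expect_congr rfl fun x _ => ?_
  by_cases hx : x ∈ M
  · rw [if_pos hx, searchFail]
    have e : ∀ ys rs, ((DTree.bisection s x ys rs).restrict M).run h
        = ((DTree.search s rs x (h x) ys).restrict M).run h := fun ys rs => by
      rw [DTree.bisection, DTree.run_restrict_query hx]
      cases h x <;> rfl
    simp only [hF, e]
  · simp [hF, DTree.bisection, DTree.restrict, hx, DTree.run, expectList_const]

/-! ### Truncations -/

theorem Cube.weight_mono {x y : Cube n} (h : x ≤ y) : x.weight ≤ y.weight :=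
  Finset.card_le_card fun i hi => by
    simp only [Finset.mem_filter, Finset.mem_univ, true_and] at hi ⊢
    exact Bool.le_iff_imp.1 (h i) hi

theorem truncate_monotone {g : Cube n → Bool} (hg : Monotone g) (δ : ℝ) :
    Monotone (truncate δ g) := by
  intro x y hxy
  have hw : (x.weight : ℝ) ≤ y.weight := by exact_mod_cast Cube.weight_mono hxy
  unfold truncate
  split_ifs <;> first | exact Bool.false_le _ | exact Bool.le_true _ | exact hg hxy | linarith

theorem truncate_apply_of_mem {δ : ℝ} {f : Cube n → Bool} {x : Cube n}
    (hx : x ∈ middleLayers n δ) : truncate δ f x = f x := by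
  rw [truncate, if_neg (not_lt.2 hx.1), if_neg (not_lt.2 hx.2)]

theorem middleLayers_subset {δ δ' : ℝ} (h : δ ≤ δ') : middleLayers n δ ⊆ middleLayers n δ' := by
  intro x hx
  rw [mem_middleLayers_iff] at hx ⊢
  exact hx.trans (mul_le_mul_of_nonneg_right h (Real.sqrt_nonneg _))

/-- Truncation does not increase distances, and it preserves monotonicity. -/
theorem IsFarFromMonotone.of_truncate {ε δ : ℝ} {f : Cube n → Bool}
    (h : IsFarFromMonotone ε (truncate δ f)) : IsFarFromMonotone ε f := by
  intro g hg
  refine (h _ (truncate_monotone hg δ)).trans ?_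
  exact_mod_cast Finset.card_le_card fun x hx => by
    simp only [Finset.mem_filter, Finset.mem_univ, true_and] at hx ⊢
    contrapose! hx
    unfold truncate
    split_ifs <;> first | rfl | exact hx

/-- The middle layers of a truncation that is far from monotone cannot be thin. -/
theorem two_mul_le_of_isFarFromMonotone_truncate {ε δ : ℝ} {f : Cube n → Bool} (hn : 1 ≤ n)
    (hε : 0 < ε) (hδ : 0 < δ) (hs : 8 / ε ≤ Real.sqrt n)
    (h : IsFarFromMonotone ε (truncate δ f)) : 2 * (ε / 8) ≤ δ := by
  by_contra hcon
  rw [not_le] at hcon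
  have hs0 : 0 < Real.sqrt n := lt_of_lt_of_le (by positivity) hs
  rw [div_le_iff₀ hε] at hs
  have h1 := h.le_prob (truncate_monotone (fun _ _ _ => le_rfl : Monotone fun _ => false) δ)
  have h2 := prob_weight_mem_Icc_le hn ((n : ℝ) / 2 - δ * Real.sqrt n)
    (ℓ := 2 * (δ * Real.sqrt n)) (by positivity)
  have h3 : prob (fun x => truncate δ f x ≠ truncate δ (fun _ => false) x) ≤
      prob (fun x : Cube n => (n : ℝ) / 2 - δ * Real.sqrt n ≤ x.weight ∧
        (x.weight : ℝ) ≤ (n : ℝ) / 2 - δ * Real.sqrt n + 2 * (δ * Real.sqrt n)) := by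
    refine prob_mono fun x hx => ?_
    contrapose! hx
    unfold truncate
    split_ifs with h4 h5
    · rfl
    · rfl
    · linarith [hx (not_lt.1 h4)]
  have h4 : (2 * (δ * Real.sqrt n) + 1) / Real.sqrt n < ε := by
    rw [div_lt_iff₀ hs0]
    nlinarith
  linarith

/-- A truncation that is far from monotone takes both values often, even at a distance from the
boundary of its middle layers: otherwise it is close to the truncation of a constant. -/
theorem half_le_prob_of_isFarFromMonotone_truncate {ε δ : ℝ} {f : Cube n → Bool} (hn : 1 ≤ n)
    (hε : 0 < ε) (hδ : ε / 8 ≤ δ) (hs : 8 / ε ≤ Real.sqrt n)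
    (h : IsFarFromMonotone ε (truncate δ f)) (b : Bool) :
    ε / 2 ≤ prob fun x : Cube n => |(x.weight : ℝ) - n / 2| ≤ (δ - ε / 8) * Real.sqrt n ∧
      truncate δ f x ≠ b := by
  have hs0 : 0 < Real.sqrt n := lt_of_lt_of_le (by positivity) hs
  rw [div_le_iff₀ hε] at hs
  have h1 := h.le_prob
    (truncate_monotone (fun _ _ _ => le_rfl : Monotone fun _ => b) (δ - ε / 8))
  have h2 := fun a => prob_weight_mem_Icc_le hn a (ℓ := ε / 8 * Real.sqrt n) (by positivity)
  have h3 : (ε / 8 * Real.sqrt n + 1) / Real.sqrt n ≤ ε / 4 := by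
    rw [div_le_iff₀ hs0]
    nlinarith
  have h4 : prob (fun x => truncate δ f x ≠ truncate (δ - ε / 8) (fun _ => b) x) ≤
      prob (fun x : Cube n => |(x.weight : ℝ) - n / 2| ≤ (δ - ε / 8) * Real.sqrt n ∧
        truncate δ f x ≠ b) +
      (prob (fun x : Cube n => (n : ℝ) / 2 - δ * Real.sqrt n ≤ x.weight ∧
        (x.weight : ℝ) ≤ (n : ℝ) / 2 - δ * Real.sqrt n + ε / 8 * Real.sqrt n) +
      prob (fun x : Cube n => (n : ℝ) / 2 + (δ - ε / 8) * Real.sqrt n ≤ x.weight ∧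
        (x.weight : ℝ) ≤ (n : ℝ) / 2 + (δ - ε / 8) * Real.sqrt n + ε / 8 * Real.sqrt n)) := by
    refine le_trans (prob_mono fun x hx => ?_)
      ((prob_or_le _ _).trans (add_le_add_right (prob_or_le _ _) _))
    by_cases hm : x ∈ middleLayers n (δ - ε / 8)
    · rw [truncate_apply_of_mem hm] at hx
      exact Or.inl ⟨mem_middleLayers_iff.1 hm, hx⟩
    · have hd : 0 ≤ (δ - ε / 8) * Real.sqrt n := mul_nonneg (by linarith) hs0.le
      have hd' : 0 ≤ ε / 8 * Real.sqrt n := by positivity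
      have e : δ * Real.sqrt n = (δ - ε / 8) * Real.sqrt n + ε / 8 * Real.sqrt n := by ring
      refine Or.inr ?_
      by_contra hcon
      push Not at hcon
      obtain ⟨c1, c2⟩ := hcon
      refine hx ?_
      unfold truncate
      split_ifs with t1 t2 t3 t4 t5 t6 t7
      · rfl
      · linarith
      · linarith
      · linarith
      · rfl
      · linarith
      · linarith [c1 (not_lt.1 t1)]
      · linarith [c2 (le_of_lt (by assumption))]
      · exact absurd ⟨not_lt.1 (by assumption), not_lt.1 (by assumption)⟩ hm
  linarith [h2 ((n : ℝ) / 2 - δ * Real.sqrt n),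
    h2 ((n : ℝ) / 2 + (δ - ε / 8) * Real.sqrt n)]

/-! ### Random pairs -/

theorem prob_weight_far_le (hn : 1 ≤ n) {κ : ℝ} (hκ : 0 < κ) :
    prob (fun x : Cube n => ¬ |(x.weight : ℝ) - n / 2| ≤ κ * Real.sqrt n)
      ≤ 1 / (4 * κ ^ 2) := by
  have hn' : (0 : ℝ) < n := by exact_mod_cast hn
  have hs : 0 < Real.sqrt n := Real.sqrt_pos.2 hn'
  have h := prob_le_abs_sum_bitSign (Finset.univ : Finset (Fin n)) (fun _ => 1) (by simp)
    (by positivity : 0 < 2 * (κ * Real.sqrt n))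
  refine (prob_mono fun x hx => ?_).trans (h.trans (le_of_eq ?_))
  · rw [weight_eq_sum, add_sub_cancel_left, ← Finset.mul_sum, abs_mul, not_le,
      abs_of_pos (by norm_num)] at hx
    simp only [one_mul]
    linarith
  · rw [Finset.card_univ, Fintype.card_fin, mul_pow, mul_pow, Real.sq_sqrt hn'.le]
    field_simp
    norm_num

theorem prob_card_diff_lt_le (x : Cube n) {N : Finset (Fin n)} {a : ℝ} (ha : 0 < a)
    (hN : 4 * a ≤ N.card) :
    prob (fun y : Cube n => ((Cube.diff x y ∩ N).card : ℝ) < a) ≤ 1 / a := by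
  have hN0 : (0 : ℝ) < N.card := by linarith
  have h := prob_le_abs_sum_bitSign N (fun i => bitSign (x i)) (fun i => abs_bitSign _)
    (by positivity : 0 < (N.card : ℝ) / 2)
  refine (prob_mono fun y hy => ?_).trans (h.trans ?_)
  · have e : Cube.diff x y ∩ N = N.filter fun i => y i ≠ x i := by
      ext i
      simp [mem_diff, and_comm, eq_comm]
    rw [e, card_filter_ne_eq] at hy
    refine le_trans ?_ (le_abs_self _)
    linarith
  · rw [div_le_div_iff₀ (by positivity) ha]
    nlinarith

theorem Cube.diff_comm (x y : Cube n) : Cube.diff x y = Cube.diff y x := by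
  ext i
  simp [mem_diff, eq_comm]

/-- The bisection between two points of different values that are far enough apart starts in a
good state, whichever of the two points has value `0`. -/
theorem pairFail_le {M : Set (Cube n)} {h : Cube n → Bool} {N : Finset (Fin n)} {s k : ℕ}
    {a g q : ℝ} (H : ∀ x y, BisectState h N a n g x y → bisectFail M h s k x y ≤ q)
    {x y : Cube n} (hx : |(x.weight : ℝ) - n / 2| ≤ g) (hy : |(y.weight : ℝ) - n / 2| ≤ g)
    (hxy : h y ≠ h x) (ha : a ≤ (Cube.diff x y ∩ N).card) :
    pairFail M h s k x y (h x) ≤ q := by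
  have hcard : ∀ x y : Cube n, ((Cube.diff x y).card : ℝ) ≤ n := fun x y => by
    exact_mod_cast (Finset.card_le_univ _).trans_eq (by simp)
  rw [pairFail]
  split_ifs with hb
  · refine H y x ⟨by simpa [hb] using hxy, hb, ?_, hcard _ _, hy, hx⟩
    rwa [Cube.diff_comm]
  · rw [Bool.not_eq_true] at hb
    exact H x y ⟨hb, by simpa [hb] using hxy, ha, hcard _ _, hx, hy⟩

/-! ### The success probability of the bisection algorithm -/

/-- A weight of a regular threshold function is at most `τ / c` times the bound that defines the
sizable negative weights. -/
theorem le_mul_norm_of_regular {c τ : ℝ} (hc : 0 < c) {w : Fin n → ℝ}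
    (hw : ∀ i, |w i| ≤ τ / Real.sqrt n * Real.sqrt (∑ j, w j ^ 2)) (j : Fin n) :
    w j ≤ τ / c * (c / Real.sqrt n * Real.sqrt (∑ j, w j ^ 2)) := by
  refine (le_abs_self _).trans ((hw j).trans (le_of_eq ?_))
  field_simp

/-- The bisection algorithm restricted to wide middle layers rejects with probability at least
one half: with high probability it finds a pair of different values near the middle, with
`Ω(n)` sizable negative weights among the coordinates in which the two points differ. -/
theorem half_le_prob_of_wide {ε τ c q δ : ℝ} {m s k : ℕ} {f h : Cube n → Bool} {w : Fin n → ℝ}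
    {θ : ℝ} (hf : IsLTFWith f w θ)
    (hw : ∀ i, |w i| ≤ τ / Real.sqrt n * Real.sqrt (∑ j, w j ^ 2))
    (hagree : ∀ z ∈ middleLayers n δ, h z = f z) (hfar : IsFarFromMonotone ε h) (hn : 1 ≤ n)
    (hc : 0 < c) (hN : c * n ≤ (negativeWeights c w).card) (hq0 : 0 ≤ q) (hq1 : q ≤ 1)
    (hq : 1 - ε ≤ q) (hqm : q ^ m ≤ 1 / 10) (hm : 40 * m ≤ c * n) (hs : 12800 ≤ s)
    (ha : 2 ^ k * (τ / c + 60 * Real.sqrt s) ≤ c * n / 4) (hb : n ≤ (2 : ℝ) ^ k * (s / 2))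
    (hg : 2 * (m + 1) * Real.sqrt n + 30 * Real.sqrt (s * 2 ^ k) + s ≤ δ * Real.sqrt n) :
    1 / 2 ≤ prob fun c : Cube n × (Fin m → Cube n) × (Fin k → Cube n) =>
      ((DTree.bisection s c.1 (List.ofFn c.2.1) (List.ofFn c.2.2)).restrict
        (middleLayers n δ)).run h = false := by
  classical
  have hn' : (0 : ℝ) < n := by exact_mod_cast hn
  set g : ℝ := 2 * (m + 1) * Real.sqrt n with hgdef
  have hgδ : g ≤ δ * Real.sqrt n := by
    have : 0 ≤ 30 * Real.sqrt (s * 2 ^ k) + s := by positivity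
    linarith
  have hπ1 : prob (fun x : Cube n => ¬ |(x.weight : ℝ) - n / 2| ≤ g) ≤ 1 / (16 * (m + 1)) := by
    refine (prob_weight_far_le hn (by positivity : (0 : ℝ) < 2 * (m + 1))).trans ?_
    exact one_div_le_one_div_of_le (by positivity) (by nlinarith [(m.cast_nonneg : (0 : ℝ) ≤ m)])
  have hstate : ∀ x y, BisectState h (negativeWeights c w) (c * n / 4) n g x y →
      bisectFail (middleLayers n δ) h s k x y ≤ 1 / 10 := fun x y hxy =>
    hxy.bisectFail_le hf hagree (ν := c / Real.sqrt n * Real.sqrt (∑ j, w j ^ 2))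
      (by positivity) (fun i hi => (Finset.mem_filter.1 hi).2) (le_mul_norm_of_regular hc hw)
      hs ha hb hg
  have hval : ∀ b, prob (fun y => h y = b) ≤ q := fun b => by
    have h1 := hfar.le_prob (fun _ _ _ => le_rfl : Monotone fun _ => b)
    have h2 := prob_add_prob_not fun y => h y = b
    linarith
  have hsearch : ∀ x : Cube n, |(x.weight : ℝ) - n / 2| ≤ g →
      searchFail (middleLayers n δ) h s m k x (h x) ≤ 7 / 16 - 1 / (16 * (m + 1)) :=
      fun x hx => by
    have hπ : prob (fun y : Cube n => ¬ (|(y.weight : ℝ) - n / 2| ≤ g ∧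
        c * n / 4 ≤ (Cube.diff x y ∩ negativeWeights c w).card))
        ≤ 1 / (16 * (m + 1)) + 1 / (c * n / 4) := by
      refine (prob_mono fun y hy => ?_).trans ((prob_or_le _ _).trans (add_le_add hπ1
        (prob_card_diff_lt_le x (N := negativeWeights c w) (by positivity) (by linarith))))
      by_cases hy1 : |(y.weight : ℝ) - n / 2| ≤ g
      · exact Or.inr (not_le.1 fun h => hy ⟨hy1, h⟩)
      · exact Or.inl hy1
    refine (searchFail_le _ (fun y hy => mem_middleLayers_iff.2 (hy.1.trans hgδ))
      (fun y hy hne => pairFail_le hstate hx hy.1 hne hy.2) (by norm_num) hq0 hq1 (hval (h x))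
      hπ m).trans ?_
    have h1 : (m : ℝ) * (1 / (c * n / 4)) ≤ 1 / 10 := by
      rw [mul_one_div, div_le_iff₀ (by positivity)]
      linarith
    have h2 : (m : ℝ) * (1 / (16 * (m + 1))) = 1 / 16 - 1 / (16 * (m + 1)) := by
      field_simp
      ring
    rw [mul_add, h2]
    linarith
  rw [prob_run_bisection_restrict]
  have htotal : 𝔼 x : Cube n, (if x ∈ middleLayers n δ then
      searchFail (middleLayers n δ) h s m k x (h x) else 1)
      ≤ (7 / 16 - 1 / (16 * (m + 1)))
        + prob (fun x : Cube n => ¬ |(x.weight : ℝ) - n / 2| ≤ g) := by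
    have h716 : (0 : ℝ) ≤ 7 / 16 - 1 / (16 * (m + 1)) := by
      have : (1 : ℝ) / (16 * (m + 1)) ≤ 1 / (16 * (0 + 1)) := by
        gcongr
        exact m.cast_nonneg
      linarith
    calc _ ≤ 𝔼 x : Cube n, ((7 / 16 - 1 / (16 * (m + 1) : ℝ))
          + if ¬ |(x.weight : ℝ) - n / 2| ≤ g then 1 else 0) := by
          refine Finset.expect_le_expect fun x _ => ?_
          by_cases hx : |(x.weight : ℝ) - n / 2| ≤ g
          · rw [if_pos (mem_middleLayers_iff.2 (hx.trans hgδ)), if_neg (not_not.2 hx), add_zero]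
            exact hsearch x hx
          · rw [if_pos hx]
            refine le_trans ?_ (le_add_of_nonneg_left h716)
            split_ifs
            exacts [searchFail_le_one _ _ _ _ _ _ _, le_rfl]
      _ = _ := by
          rw [Finset.expect_add_distrib, Finset.expect_const Finset.univ_nonempty, prob]
          congr!
  linarith

/-- The bisection algorithm rejects a truncation with middle layers of any width with
probability bounded below: with constant probability the first point, the first candidate and
the first `T` points of the loop lie at some distance from the boundary of the middle layers,
and then the loop is unlikely to leave them. -/
theorem le_prob_of_truncate {ε τ c δ p : ℝ} {m s k T : ℕ} {f : Cube n → Bool} {w : Fin n → ℝ}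
    {θ : ℝ} (hε : 0 < ε) (hδ : 0 < δ) (hf : IsLTFWith f w θ)
    (hw : ∀ i, |w i| ≤ τ / Real.sqrt n * Real.sqrt (∑ j, w j ^ 2))
    (hfar : IsFarFromMonotone ε (truncate δ f)) (hn : 1 ≤ n)
    (hc : 0 < c) (hN : c * n ≤ (negativeWeights c w).card) (hp : 0 < p)
    (hp' : ∀ D : Finset (Fin n),
      p ≤ prob fun r : Cube n => 0 ≤ 1 / 2 * ∑ i ∈ D, bitSign (r i) ∧
        1 / 2 * ∑ i ∈ D, bitSign (r i) ≤ ε / 8 * Real.sqrt n)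
    (hsqrt : 8 / ε ≤ Real.sqrt n) (hcn : 16 / ε ≤ c * n)
    (hbad : 8 * n * 16 ^ T / (c * n / 4) ^ 2 ≤ p / 2) (hs : 12800 ≤ s)
    (ha : 2 ^ k * (τ / c + 60 * Real.sqrt s) ≤ c * n / 4 / 4 ^ T)
    (hb : n * (3 / 4) ^ T ≤ (2 : ℝ) ^ k * (s / 2))
    (hg : 30 * Real.sqrt (s * 2 ^ k) + s ≤ ε / 8 * Real.sqrt n) :
    ε ^ 2 / 8 * ((p / 2) ^ T * (9 / 10)) ≤
      prob fun c : Cube n × (Fin (m + 1) → Cube n) × (Fin (k + T) → Cube n) =>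
        ((DTree.bisection s c.1 (List.ofFn c.2.1) (List.ofFn c.2.2)).restrict
          (middleLayers n δ)).run (truncate δ f) = false := by
  classical
  have hn' : (0 : ℝ) < n := by exact_mod_cast hn
  have hδ2 := two_mul_le_of_isFarFromMonotone_truncate hn hε hδ hsqrt hfar
  have hboth := half_le_prob_of_isFarFromMonotone_truncate hn hε (by linarith) hsqrt hfar
  set h := truncate δ f with hh
  set g : ℝ := (δ - ε / 8) * Real.sqrt n with hgdef
  have hs0 := Real.sqrt_nonneg (n : ℝ)
  have hgδ : g ≤ δ * Real.sqrt n := mul_le_mul_of_nonneg_right (by linarith) hs0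
  have hμg : ε / 8 * Real.sqrt n ≤ g := mul_le_mul_of_nonneg_right (by linarith) hs0
  set q : ℝ := (p / 2) ^ T * (9 / 10) with hq
  have hq0 : 0 ≤ q := by positivity
  have hcn1 : c * n / 4 ≤ n := by
    have : ((negativeWeights c w).card : ℝ) ≤ n := by
      exact_mod_cast (Finset.card_le_univ _).trans_eq (by simp)
    linarith
  have hstate : ∀ x y, BisectState h (negativeWeights c w) (c * n / 4) n g x y →
      bisectFail (middleLayers n δ) h s (k + T) x y ≤ 1 - q := fun x y hxy => by
    refine hxy.bisectFail_add_le (p := p) hgδ (fun x y hx hy => le_prob_mix_mem hp' hμg hx hy)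
      hp.le (by norm_num) (fun x y hxy => ?_) (by positivity) hcn1 hbad
    refine (hxy.bisectFail_le hf (fun z hz => truncate_apply_of_mem hz)
      (ν := c / Real.sqrt n * Real.sqrt (∑ j, w j ^ 2)) (by positivity)
      (fun i hi => (Finset.mem_filter.1 hi).2) (le_mul_norm_of_regular hc hw) hs ha hb ?_).trans
      (by norm_num)
    rw [hgdef, sub_mul]
    linarith
  have hsearch : ∀ x : Cube n, |(x.weight : ℝ) - n / 2| ≤ g →
      searchFail (middleLayers n δ) h s (m + 1) (k + T) x (h x) ≤ 1 - q * (ε / 4) :=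
      fun x hx => by
    let good : Cube n → Prop := fun y => (|(y.weight : ℝ) - n / 2| ≤ g ∧ h y ≠ h x) ∧
      c * n / 4 ≤ (Cube.diff x y ∩ negativeWeights c w).card
    have hgood : ε / 4 ≤ prob good := by
      have h1 : prob (fun y : Cube n => |(y.weight : ℝ) - n / 2| ≤ g ∧ h y ≠ h x)
          ≤ prob good + prob (fun y : Cube n =>
            ((Cube.diff x y ∩ negativeWeights c w).card : ℝ) < c * n / 4) := by
        refine (prob_mono fun y hy => ?_).trans (prob_or_le _ _)
        rcases le_or_gt (c * n / 4) ((Cube.diff x y ∩ negativeWeights c w).card : ℝ) with h | h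
        · exact Or.inl ⟨hy, h⟩
        · exact Or.inr h
      have h2 := prob_card_diff_lt_le x (N := negativeWeights c w) (a := c * n / 4)
        (by positivity) (by linarith)
      have h3 : 1 / (c * n / 4) ≤ ε / 4 := by
        rw [div_le_iff₀ hε] at hcn
        rw [div_le_iff₀ (by positivity)]
        linarith
      linarith [hboth (h x)]
    refine (searchFail_succ_le good (fun y hy => mem_middleLayers_iff.2 (hy.1.1.trans hgδ))
      (fun y hy => hy.1.2) (fun y hy => pairFail_le hstate hx hy.1.1 hy.1.2 hy.2)).trans ?_
    gcongr
  rw [prob_run_bisection_restrict]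
  have htotal : 𝔼 x : Cube n, (if x ∈ middleLayers n δ then
      searchFail (middleLayers n δ) h s (m + 1) (k + T) x (h x) else 1)
      ≤ 1 - q * (ε / 4) * prob (fun x : Cube n => |(x.weight : ℝ) - n / 2| ≤ g) := by
    calc _ ≤ 𝔼 x : Cube n, (1 - q * (ε / 4)
          * if |(x.weight : ℝ) - n / 2| ≤ g then 1 else 0) := by
          refine Finset.expect_le_expect fun x _ => ?_
          by_cases hx : |(x.weight : ℝ) - n / 2| ≤ g
          · rw [if_pos (mem_middleLayers_iff.2 (hx.trans hgδ)), if_pos hx, mul_one]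
            exact hsearch x hx
          · rw [if_neg hx, mul_zero, sub_zero]
            split_ifs
            exacts [searchFail_le_one _ _ _ _ _ _ _, le_rfl]
      _ = _ := by
          rw [Finset.expect_sub_distrib, Finset.expect_const Finset.univ_nonempty,
            ← Finset.mul_expect, prob]
  have hx : ε / 2 ≤ prob (fun x : Cube n => |(x.weight : ℝ) - n / 2| ≤ g) :=
    (hboth true).trans (prob_mono fun x hx => hx.1)
  have : q * (ε / 4) * (ε / 2)
      ≤ q * (ε / 4) * prob (fun x : Cube n => |(x.weight : ℝ) - n / 2| ≤ g) := by gcongr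
  linarith

/-! ### The choice of the parameters -/

/-- The parameters of the bisection. The number `T` of initial steps makes the later steps short
compared to `ε * √n`. Then `s = 4 * 3 ^ T * K`, where `K` is so large that the `k + T` steps,
with `4 ^ T * K * 2 ^ k ≈ n`, leave enough negative weights. Of the two groups of bounds, the
first one is for all `k + T` steps, starting from points that differ in about `n` coordinates,
and the second one for the last `k` steps, when the first `T` steps have divided the number of
these coordinates by `(4 / 3) ^ T` at least, and the number of negative weights among them by
`4 ^ T` at most. -/
theorem exists_bisection_parameters {ε c κ : ℝ} (hε : 0 < ε) (hc : 0 < c) :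
    ∃ (T s n₂ : ℕ) (d : ℝ), 12800 ≤ s ∧ 0 ≤ d ∧ ∀ n : ℕ, n₂ ≤ n → ∃ k : ℕ, 2 ^ (k + T) ≤ n ∧
      ((2 : ℝ) ^ (k + T) * (κ + 60 * Real.sqrt s) ≤ c * n / 4 ∧
        (n : ℝ) ≤ 2 ^ (k + T) * (s / 2) ∧
        30 * Real.sqrt (s * 2 ^ (k + T)) + s ≤ d * Real.sqrt n) ∧
      ((2 : ℝ) ^ k * (κ + 60 * Real.sqrt s) ≤ c * n / 4 / 4 ^ T ∧
        (n : ℝ) * (3 / 4) ^ T ≤ 2 ^ k * (s / 2) ∧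
        30 * Real.sqrt (s * 2 ^ k) + s ≤ ε / 8 * Real.sqrt n) := by
  obtain ⟨T, hT⟩ := exists_pow_lt_of_lt_one (by positivity : 0 < (ε / 960) ^ 2)
    (by norm_num : (3 / 4 : ℝ) < 1)
  set D := Real.sqrt (4 * 3 ^ T) with hD
  obtain ⟨K, hK⟩ := exists_nat_ge (max 3200 (max (8 * κ / c) ((480 * D / c) ^ 2)))
  have hK1 : (3200 : ℝ) ≤ K := (le_max_left _ _).trans hK
  have hK2 : 8 * κ / c ≤ K := (le_max_left _ _).trans ((le_max_right _ _).trans hK)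
  have hK3 : (480 * D / c) ^ 2 ≤ K := (le_max_right _ _).trans ((le_max_right _ _).trans hK)
  have hK0 : (0 : ℝ) < K := by linarith
  set s := 4 * 3 ^ T * K with hs
  have hsR : (s : ℝ) = 4 * 3 ^ T * K := by rw [hs]; push_cast; rfl
  have hsqrt_s : Real.sqrt s = D * Real.sqrt K := by rw [hsR, Real.sqrt_mul (by positivity)]
  -- The number of surviving negative weights is of order `K`, the deviations of order `√K`.
  have hmain : κ + 60 * Real.sqrt s ≤ c / 4 * K := by
    have h1 : 480 * D / c ≤ Real.sqrt K := Real.le_sqrt_of_sq_le hK3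
    rw [div_le_iff₀ hc] at h1 hK2
    have h2 : 480 * D * Real.sqrt K ≤ Real.sqrt K * c * Real.sqrt K := by gcongr
    have h3 : Real.sqrt K * Real.sqrt K = K := Real.mul_self_sqrt hK0.le
    have h4 : Real.sqrt K * c * Real.sqrt K = c * K := by rw [mul_right_comm, h3, mul_comm]
    rw [hsqrt_s]
    linarith
  obtain ⟨n₂, hn₂⟩ := exists_nat_ge (max (4 ^ T * K : ℝ) (max (s ^ 2 : ℝ) ((16 * s / ε) ^ 2)))
  refine ⟨T, s, n₂, 30 * D + 1, ?_, by positivity, fun n hn => ?_⟩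
  · have h1 : 3200 ≤ K := by exact_mod_cast hK1
    have h2 : 1 ≤ 3 ^ T := Nat.one_le_pow _ _ (by norm_num)
    nlinarith
  have hn' : (n₂ : ℝ) ≤ n := by exact_mod_cast hn
  have hnK : (4 ^ T * K : ℝ) ≤ n := (le_max_left _ _).trans (hn₂.trans hn')
  have hns : (s : ℝ) ≤ Real.sqrt n := Real.le_sqrt_of_sq_le
    ((le_max_left _ _).trans ((le_max_right _ _).trans (hn₂.trans hn')))
  have hnε : 16 * s / ε ≤ Real.sqrt n := Real.le_sqrt_of_sq_le
    ((le_max_right _ _).trans ((le_max_right _ _).trans (hn₂.trans hn')))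
  have hn0 : (0 : ℝ) < n := lt_of_lt_of_le (by positivity) hnK
  have hKnat : 0 < 4 ^ T * K := by
    have : 0 < K := by exact_mod_cast hK0
    positivity
  have hdiv : n / (4 ^ T * K) ≠ 0 := by
    refine (Nat.div_pos ?_ hKnat).ne'
    exact_mod_cast hnK
  set k := Nat.log 2 (n / (4 ^ T * K)) with hk
  have hk1 : (2 : ℝ) ^ k * (4 ^ T * K) ≤ n := by
    exact_mod_cast (Nat.le_div_iff_mul_le hKnat).1 (Nat.pow_log_le_self 2 hdiv)
  have hk2 : (n : ℝ) ≤ 2 * (2 : ℝ) ^ k * (4 ^ T * K) := by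
    have h := (Nat.div_lt_iff_lt_mul hKnat).1
      (Nat.lt_pow_succ_log_self (by norm_num : 1 < 2) (n / (4 ^ T * K)))
    rw [← hk, pow_succ, mul_comm (2 ^ k) 2] at h
    exact_mod_cast h.le
  have h24 : (2 : ℝ) ^ T ≤ 4 ^ T := pow_le_pow_left₀ (by norm_num) (by norm_num) T
  have h46 : (4 : ℝ) ^ T ≤ 2 ^ T * 3 ^ T := by
    rw [← mul_pow]
    exact pow_le_pow_left₀ (by norm_num) (by norm_num) T
  have h34 : (3 / 4 : ℝ) ^ T * 4 ^ T = 3 ^ T := by rw [← mul_pow]; norm_num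
  have h2k : (2 : ℝ) ^ k * 2 ^ T * K ≤ n := by
    refine le_trans ?_ hk1
    rw [mul_assoc]
    gcongr
  refine ⟨k, ?_, ⟨?_, ?_, ?_⟩, ?_, ?_, ?_⟩
  · have h : (2 : ℝ) ^ (k + T) ≤ n := by
      rw [pow_add]
      refine le_trans ?_ h2k
      exact le_mul_of_one_le_right (by positivity) (by linarith)
    exact_mod_cast h
  · calc (2 : ℝ) ^ (k + T) * (κ + 60 * Real.sqrt s) ≤ 2 ^ (k + T) * (c / 4 * K) := by gcongr
      _ = c / 4 * (2 ^ k * 2 ^ T * K) := by ring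
      _ ≤ c / 4 * n := by gcongr
      _ = _ := by ring
  · calc (n : ℝ) ≤ 2 * (2 : ℝ) ^ k * (4 ^ T * K) := hk2
      _ ≤ 2 * (2 : ℝ) ^ k * (2 ^ T * 3 ^ T * K) := by gcongr
      _ = _ := by rw [hsR]; ring
  · have h : Real.sqrt (s * 2 ^ (k + T)) ≤ D * Real.sqrt n := by
      rw [hD, ← Real.sqrt_mul (by positivity)]
      refine Real.sqrt_le_sqrt ?_
      calc (s : ℝ) * 2 ^ (k + T) = 4 * 3 ^ T * (2 ^ k * 2 ^ T * K) := by rw [hsR]; ring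
        _ ≤ _ := by gcongr
    linarith
  · calc (2 : ℝ) ^ k * (κ + 60 * Real.sqrt s) ≤ 2 ^ k * (c / 4 * K) := by gcongr
      _ = c / 4 * (2 ^ k * (4 ^ T * K)) / 4 ^ T := by field_simp
      _ ≤ c / 4 * n / 4 ^ T := by gcongr
      _ = _ := by ring
  · calc (n : ℝ) * (3 / 4) ^ T ≤ 2 * (2 : ℝ) ^ k * (4 ^ T * K) * (3 / 4) ^ T := by gcongr
      _ = 2 * (2 : ℝ) ^ k * K * ((3 / 4) ^ T * 4 ^ T) := by ring
      _ = _ := by rw [h34, hsR]; ring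
  · have h : Real.sqrt (s * 2 ^ k) ≤ 2 * (ε / 960) * Real.sqrt n := by
      refine Real.sqrt_le_iff.2 ⟨by positivity, ?_⟩
      calc (s : ℝ) * 2 ^ k = 4 * ((3 / 4) ^ T * 4 ^ T) * K * 2 ^ k := by rw [h34, hsR]
        _ = 4 * (3 / 4) ^ T * (2 ^ k * (4 ^ T * K)) := by ring
        _ ≤ 4 * (ε / 960) ^ 2 * n := by gcongr
        _ = (2 * (ε / 960) * Real.sqrt n) ^ 2 := by
            rw [mul_pow, mul_pow, Real.sq_sqrt hn0.le]
            ring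
    rw [div_le_iff₀ hε] at hnε
    linarith

/-! ### The testers -/

section Testers

variable {ε : ℝ}

theorem IsFarFromMonotone.not_monotone {f : Cube n → Bool} (hε : 0 < ε)
    (h : IsFarFromMonotone ε f) : ¬ Monotone f := fun hf => by
  have h1 := h f hf
  simp only [ne_eq, not_true_eq_false, Finset.filter_false, Finset.card_empty,
    Nat.cast_zero] at h1
  have : 0 < ε * 2 ^ n := by positivity
  linarith

/-- The exhaustive test is a tester for every class of functions. -/
theorem testsMonotonicity_exhaustive (hε : 0 < ε) (F : Set (Cube n → Bool)) :
    RandAlg.TestsMonotonicity (PMF.pure (DTree.exhaustive n)) ε F := by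
  constructor
  · intro f _ hf T hT
    rw [PMF.mem_support_pure_iff] at hT
    rw [hT, DTree.run_exhaustive]
    exact hf
  · intro f _ hf
    have h : (DTree.exhaustive n).run f = false := by
      rw [← Bool.not_eq_true, DTree.run_exhaustive]
      exact hf.not_monotone hε
    simp [RandAlg.rejectProb, PMF.pure_map, h]

theorem rejectProb_bisection_restrict (M : Set (Cube n)) (f : Cube n → Bool) (m k s : ℕ) :
    ((RandAlg.bisection n m k s).restrict M).rejectProb f = ENNReal.ofReal
      (prob fun c : Cube n × (Fin m → Cube n) × (Fin k → Cube n) =>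
        ((DTree.bisection s c.1 (List.ofFn c.2.1) (List.ofFn c.2.2)).restrict M).run f
          = false) := by
  rw [RandAlg.restrict, RandAlg.bisection, PMF.map_comp, RandAlg.rejectProb_map_uniform]
  rfl

theorem le_rejectProb_bisection (M : Set (Cube n)) (f : Cube n → Bool) (m k s : ℕ) :
    ENNReal.ofReal (prob fun c : Cube n × (Fin m → Cube n) × (Fin k → Cube n) =>
        ((DTree.bisection s c.1 (List.ofFn c.2.1) (List.ofFn c.2.2)).restrict M).run f
          = false) ≤ (RandAlg.bisection n m k s).rejectProb f := by
  rw [RandAlg.bisection, RandAlg.rejectProb_map_uniform]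
  exact ENNReal.ofReal_le_ofReal (prob_mono fun c hc => DTree.run_of_run_restrict hc)

theorem mem_middleLayers_of_sqrt_le {δ : ℝ} (h : Real.sqrt n ≤ δ) (x : Cube n) :
    x ∈ middleLayers n δ := by
  rw [mem_middleLayers_iff]
  have h1 : (x.weight : ℝ) ≤ n := by
    exact_mod_cast (Finset.card_le_univ _).trans_eq (by simp)
  have h2 : (0 : ℝ) ≤ x.weight := Nat.cast_nonneg _
  have h3 : Real.sqrt n * Real.sqrt n ≤ δ * Real.sqrt n := by gcongr
  rw [Real.mul_self_sqrt (Nat.cast_nonneg n)] at h3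
  rw [abs_le]
  constructor <;> linarith

end Testers

theorem theorem2 (ε τ : ℝ) (hε : 0 < ε) (hτ : 0 < τ) :
    ∃ (C δ₀ : ℝ) (n₀ m s R : ℕ), 0 < δ₀ ∧ ∀ n : ℕ, 1 ≤ n →
      (∃ A : RandAlg n,
        A.QueriesAtMost (C + Real.logb 2 n) ∧
        A.QueriesIn (middleLayers n δ₀) ∧
        A.TestsMonotonicity ε (regularLTFs n τ) ∧
        A.TestsMonotonicity ε (truncatedRegularLTFs n τ (Set.Ici δ₀)) ∧
        (n₀ ≤ n → ∃ k : ℕ, A = (RandAlg.bisection n m k s).restrict (middleLayers n δ₀))) ∧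
      (∃ B : RandAlg n,
        B.QueriesAtMost (C * (1 + Real.logb 2 n)) ∧
        B.TestsMonotonicity ε (truncatedRegularLTFs n τ (Set.Ioi 0)) ∧
        (n₀ ≤ n → ∃ k : ℕ, B = (RandAlg.bisection n m k s).runs R)) := by
  obtain ⟨c, hc, n₁, hneg⟩ := exists_le_card_negativeWeights hε hτ
  obtain ⟨p, hp, hthin⟩ := exists_le_prob_sum_bitSign (by positivity : 0 < ε / 8)
  obtain ⟨T, s, n₂, d, hs, hd, hpar⟩ :=
    exists_bisection_parameters (κ := τ / c) hε hc
  set q := max (1 - ε) 0 with hq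
  have hq0 : 0 ≤ q := le_max_right _ _
  have hq1 : q < 1 := max_lt (by linarith) (by norm_num)
  obtain ⟨m, hm⟩ := exists_pow_lt_of_lt_one (by norm_num : (0 : ℝ) < 1 / 10) hq1
  set p₀ := ε ^ 2 / 8 * ((p / 2) ^ T * (9 / 10)) with hp₀
  have hp₀0 : 0 < p₀ := by positivity
  obtain ⟨R, hR⟩ := exists_pow_lt_of_lt_one (by norm_num : (0 : ℝ) < 1 / 2)
    (by linarith : 1 - p₀ < 1)
  obtain ⟨n₃, hn₃⟩ := exists_nat_ge ((16 / ε) ^ 2 + 16 / ε / c + 40 * (m + 1) / c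
    + 256 * 16 ^ T / (c ^ 2 * p))
  set n₀ := n₁ + n₂ + n₃ with hn₀
  set δ₀ := 2 * ((m + 1 : ℕ) + 1) + d + Real.sqrt n₀ with hδ₀
  have hδ₀0 : 0 < δ₀ := by positivity
  set C₁ : ℝ := 1 + (m + 1) + 2 ^ s with hC₁
  have hC₁1 : 1 ≤ C₁ := by
    have : (0 : ℝ) ≤ (m + 1) + 2 ^ s := by positivity
    linarith
  set C := (R + 1) * C₁ + 2 ^ n₀ with hC
  have hC1 : C₁ ≤ C := by
    have : 0 ≤ R * C₁ + 2 ^ n₀ := by positivity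
    linarith
  have hC2 : (2 : ℝ) ^ n₀ ≤ C := by
    have : 0 ≤ (R + 1) * C₁ := by positivity
    linarith
  have hC3 : R * C₁ ≤ C := by
    have : (0 : ℝ) ≤ C₁ + 2 ^ n₀ := by positivity
    linarith
  refine ⟨C, δ₀, n₀, m + 1, s, R, hδ₀0, fun n hn => ?_⟩
  have hn' : (1 : ℝ) ≤ n := by exact_mod_cast hn
  have hlog : 0 ≤ Real.logb 2 n := Real.logb_nonneg (by norm_num) hn'
  rcases lt_or_ge n n₀ with hlt | hge
  · -- The middle layers are the whole cube, and exhaustive search is affordable.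
    have hdepth : RandAlg.QueriesAtMost (PMF.pure (DTree.exhaustive n)) C := by
      intro T hT
      rw [PMF.mem_support_pure_iff] at hT
      rw [hT]
      refine le_trans ?_ hC2
      exact_mod_cast (DTree.depth_exhaustive_le n).trans
        (Nat.pow_le_pow_right (by norm_num) hlt.le)
    refine ⟨⟨PMF.pure (DTree.exhaustive n), fun T hT => (hdepth T hT).trans (by linarith),
      fun T _ => DTree.queriesIn_exhaustive (mem_middleLayers_of_sqrt_le ?_) T,
      testsMonotonicity_exhaustive hε _, testsMonotonicity_exhaustive hε _,
      fun h => absurd h (not_le.2 hlt)⟩,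
      PMF.pure (DTree.exhaustive n), fun T hT => (hdepth T hT).trans ?_,
      testsMonotonicity_exhaustive hε _, fun h => absurd h (not_le.2 hlt)⟩
    · have h1 : Real.sqrt n ≤ Real.sqrt n₀ := Real.sqrt_le_sqrt (by exact_mod_cast hlt.le)
      have h2 : (0 : ℝ) ≤ 2 * ((m + 1 : ℕ) + 1) + d := by positivity
      linarith
    · exact le_mul_of_one_le_right (by linarith) (by linarith)
  · obtain ⟨k, hkn, ⟨ha1, hb1, hg1⟩, ha2, hb2, hg2⟩ := hpar n (by omega)
    have hn3 : (16 / ε) ^ 2 + 16 / ε / c + 40 * (m + 1) / c + 256 * 16 ^ T / (c ^ 2 * p) ≤ n :=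
      hn₃.trans (by exact_mod_cast (by omega : n₃ ≤ n))
    have e1 : 0 ≤ (16 / ε) ^ 2 := by positivity
    have e2 : 0 ≤ 16 / ε / c := by positivity
    have e3 : 0 ≤ 40 * (m + 1 : ℝ) / c := by positivity
    have e4 : 0 ≤ 256 * 16 ^ T / (c ^ 2 * p) := by positivity
    have hsqrt : 16 / ε ≤ Real.sqrt n := Real.le_sqrt_of_sq_le (by linarith)
    have hcn : 16 / ε ≤ c * n := by
      have : 16 / ε / c ≤ n := by linarith
      rwa [div_le_iff₀' hc] at this
    have hmn : 40 * ((m + 1 : ℕ) : ℝ) ≤ c * n := by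
      have : 40 * (m + 1 : ℝ) / c ≤ n := by linarith
      rw [div_le_iff₀' hc] at this
      exact_mod_cast this
    have hbad : 8 * n * 16 ^ T / (c * n / 4) ^ 2 ≤ p / 2 := by
      have h1 : 256 * 16 ^ T / (c ^ 2 * p) ≤ n := by linarith
      rw [div_le_iff₀ (by positivity)] at h1
      rw [div_le_iff₀ (by positivity)]
      nlinarith
    have hklog : ((k + T : ℕ) : ℝ) ≤ Real.logb 2 n := by
      rw [Real.le_logb_iff_rpow_le (by norm_num) (by linarith), Real.rpow_natCast]
      exact_mod_cast hkn
    have hdepth : (RandAlg.bisection n (m + 1) (k + T) s).QueriesAtMost (C₁ + Real.logb 2 n) :=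
      fun S hS => (RandAlg.queriesAtMost_bisection n (m + 1) (k + T) s S hS).trans (by
        push_cast at hklog ⊢
        linarith)
    have hsuccess : ∀ (f h : Cube n → Bool), f ∈ regularLTFs n τ →
        (∀ z ∈ middleLayers n δ₀, h z = f z) → IsFarFromMonotone ε f → IsFarFromMonotone ε h →
        1 / 2 ≤ ((RandAlg.bisection n (m + 1) (k + T) s).restrict
          (middleLayers n δ₀)).rejectProb h := by
      rintro f h ⟨w, θ, hf, hw⟩ hagree hfarf hfar
      have hN := hneg n (by omega) f w θ hf hw hfarf
      have key := half_le_prob_of_wide (m := m + 1) hf hw hagree hfar hn hc hN hq0 hq1.le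
        (le_max_left _ _) ((pow_le_pow_of_le_one hq0 hq1.le (Nat.le_succ m)).trans hm.le) hmn hs
        ha1 hb1 (by
          have : 0 ≤ Real.sqrt n₀ * Real.sqrt n := by positivity
          rw [hδ₀, add_mul, add_mul]
          linarith)
      rw [rejectProb_bisection_restrict]
      calc (1 / 2 : ENNReal) = ENNReal.ofReal (1 / 2) := by
            rw [ENNReal.ofReal_div_of_pos (by norm_num)]
            simp
        _ ≤ _ := ENNReal.ofReal_le_ofReal key
    have haccept := fun f (hf : Monotone f) =>
      RandAlg.alwaysAccepts_bisection (n := n) hf (m + 1) (k + T) s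
    refine ⟨⟨(RandAlg.bisection n (m + 1) (k + T) s).restrict (middleLayers n δ₀),
      fun S hS => (hdepth.restrict _ S hS).trans (by linarith), RandAlg.queriesIn_restrict _ _,
      ⟨fun f _ hf => (haccept f hf).restrict _,
        fun f hf hfar => hsuccess f f hf (fun _ _ => rfl) hfar hfar⟩,
      ⟨fun f _ hf => (haccept f hf).restrict _, ?_⟩, fun _ => ⟨k + T, rfl⟩⟩,
      (RandAlg.bisection n (m + 1) (k + T) s).runs R,
      fun S hS => (hdepth.runs R S hS).trans ?_,
      ⟨fun f _ hf => (haccept f hf).runs R, ?_⟩, fun _ => ⟨k + T, rfl⟩⟩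
    · rintro _ ⟨δ, hδ, f, hf, rfl⟩ hfar
      exact hsuccess f _ hf
        (fun z hz => truncate_apply_of_mem (middleLayers_subset hδ hz)) hfar.of_truncate hfar
    · have h1 : R * Real.logb 2 n ≤ C * Real.logb 2 n := by
        refine mul_le_mul_of_nonneg_right (le_trans ?_ hC3) hlog
        exact le_mul_of_one_le_right (Nat.cast_nonneg R) hC₁1
      linarith
    · rintro _ ⟨δ, hδ, f, ⟨w, θ, hf, hw⟩, rfl⟩ hfar
      have hN := hneg n (by omega) f w θ hf hw hfar.of_truncate
      have h8 : 8 / ε ≤ Real.sqrt n := le_trans (by gcongr; norm_num) hsqrt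
      have key := le_prob_of_truncate (m := m) hε hδ hf hw hfar hn hc hN hp
        (hthin n (le_of_eq_of_le (by field_simp; norm_num) hsqrt)) h8 hcn hbad hs ha2 hb2 hg2
      exact RandAlg.half_le_rejectProb_runs (key.trans (prob_le_one _))
        ((ENNReal.ofReal_le_ofReal key).trans (le_rejectProb_bisection _ _ _ _ _)) hR.le
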